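/- Let $n\ge 1$ and equip $\mathbb{R}^{2n}$ with its Euclidean inner product and $J=\begin{pmatrix}0&-I_n\\ I_n&0\end{pmatrix}$. Let $K\subset\mathbb{R}^{2n}$ be a convex polytope with $0\in\mathrm{Int}(K)$, let $F_1,\dots,F_N$ be its $(2n-1)$-dimensional facets, and let $n_i$ be the unit outer normal to $F_i$. For $x\in\partial K$ let $N_{\partial K}(x)=\{y\in\mathbb{R}^{2n}\mid \langle u-x,y\rangle\le 0\ \text{for all } u\in K\}$. For $\Psi\in\mathrm{Sp}(2n,\mathbb{R})$, a generalized $\Psi$-characteristic on $\partial K$ is a nonconstant absolutely continuous curve $z:[0,T]\to\mathbb{R}^{2n}$ (for some $T>0$) such that $z([0,T])\subset\partial K$, $z(T)=\Psi z(0)$ and $\dot z(t)\in J N_{\partial K}(z(t))$ for almost every $t$; its action is $A(z)=\frac12\int_0^T\langle -J\dot z,z\rangle\,dt$. Theorem. For every $\Psi\in\mathrm{Sp}(2n,\mathbb{R})$ there exists a generalized $\Psi$-characteristic $\gamma:[0,1]\to\partial K$ such that the following hold. (1) $A(\gamma)=\min\{A(x)>0\mid x \text{ is a generalized } \Psi\text{-characteristic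 on } \partial K\}$; in particular the minimum exists. (2) $\dot\gamma$ is piecewise constant: there are $m\ge 1$, vectors $w_1,\dots,w_m\in\mathbb{R}^{2n}$ and $0=\tau_0<\tau_1<\cdots<\tau_m=1$ with $\dot\gamma(t)=w_j$ for $\tau_{j-1}<t<\tau_j$. For each $j$ there are $i\in\{1,\dots,N\}$ and $C_j>0$ with $w_j=C_jJn_i$, and for each $i$ there is at most one $j$ such that $w_j$ is a positive multiple of $Jn_i$. (3) For each $i$ and each $C>0$ the set $\{t\in[0,1]\mid\dot\gamma(t)=CJn_i\}$ is empty or connected, and for each $i$ the set $\{t\in[0,1]\mid \dot\gamma(t)=CJn_i\text{ for some } C>0\}$ is empty or connected (derivatives at $0$ and $1$ are one-sided). (4) $\dot\gamma$ has at most $N$ points of discontinuity in $[0,1]$ (points where $\gamma$ is not differentiable being counted as such), and $\gamma$ visits the interior of each facet at most once: for each $i$, the set of $t\in[0,1]$ for which $\gamma(t)$ lies in the relative interior of $F_i$ is empty or connected. -/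

import Mathlib

open MeasureTheory Set

namespace SymplecticPolytope

/-- The standard Euclidean space `ℝ²ⁿ`, with coordinates `(q₁, …, qₙ, p₁, …, pₙ)` and its
Euclidean norm and inner product. -/
abbrev Phase (n : ℕ) : Type := EuclideanSpace ℝ (Fin n ⊕ Fin n)

/-- A real `2n × 2n` matrix acting on `ℝ²ⁿ`. -/
noncomputable def act {n : ℕ} (M : Matrix (Fin n ⊕ Fin n) (Fin n ⊕ Fin n) ℝ) :
    Phase n →L[ℝ] Phase n :=
  Matrix.toEuclideanCLM (𝕜 := ℝ) M

/-- The standard complex structure `J = [[0, -I], [I, 0]]` on `ℝ²ⁿ`. -/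
noncomputable def stdJ (n : ℕ) : Phase n →L[ℝ] Phase n :=
  act (Matrix.J (Fin n) ℝ)

/-- A convex polytope: a bounded intersection of finitely many closed half-spaces. -/
def IsPolytope {n : ℕ} (K : Set (Phase n)) : Prop :=
  Bornology.IsBounded K ∧
    ∃ s : Finset (Phase n × ℝ), K = {x | ∀ p ∈ s, inner ℝ x p.1 ≤ p.2}

/-- A facet of `K`: an exposed face of dimension `2n - 1`. -/
def IsFacet {n : ℕ} (K F : Set (Phase n)) : Prop :=
  IsExposed ℝ K F ∧ Module.finrank ℝ (vectorSpan ℝ F) + 1 = 2 * n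

/-- The outward normal cone of `K` at `x`. -/
def normalCone {n : ℕ} (K : Set (Phase n)) (x : Phase n) : Set (Phase n) :=
  {y | ∀ u ∈ K, inner ℝ (u - x) y ≤ 0}

/-- `ν` is a unit outer normal of `K` along the face `F`. -/
def IsUnitOuterNormal {n : ℕ} (K F : Set (Phase n)) (ν : Phase n) : Prop :=
  ‖ν‖ = 1 ∧ ∀ x ∈ F, ν ∈ normalCone K x

/-- `F₁, …, F_N` are all the facets of `K`, listed without repetition, and `ν₁, …, ν_N` are
their unit outer normals. -/
structure IsFacetList {n : ℕ} (K : Set (Phase n)) {N : ℕ} (F : Fin N → Set (Phase n))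
    (ν : Fin N → Phase n) : Prop where
  injective : Function.Injective F
  range_eq : Set.range F = {S | IsFacet K S}
  normal : ∀ i, IsUnitOuterNormal K (F i) (ν i)

/-- `z : [0, T] → ℝ²ⁿ` is a generalized `Ψ`-characteristic on `∂K`: a nonconstant absolutely
continuous curve in `∂K` with `z(T) = Ψ z(0)` and `ż(t) ∈ J N(z(t))` for almost every `t`.
Only the values of `z` on `[0, T]` matter. -/
structure IsGenCharacteristic {n : ℕ} (K : Set (Phase n))
    (Ψ : Matrix (Fin n ⊕ Fin n) (Fin n ⊕ Fin n) ℝ) (T : ℝ) (z : ℝ → Phase n) : Prop where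
  pos : 0 < T
  absCont : AbsolutelyContinuousOnInterval z 0 T
  nonconstant : ∃ t ∈ Icc 0 T, z t ≠ z 0
  mem_boundary : ∀ t ∈ Icc 0 T, z t ∈ frontier K
  endpoint : z T = act Ψ (z 0)
  velocity : ∀ᵐ t ∂(volume.restrict (Icc 0 T)),
    ∃ y ∈ normalCone K (z t), HasDerivAt z (stdJ n y) t

/-- The action `A(z) = ½ ∫₀ᵀ ⟨-J ż, z⟩ dt`. -/
noncomputable def action {n : ℕ} (T : ℝ) (z : ℝ → Phase n) : ℝ :=
  (1 / 2) * ∫ t in (0 : ℝ)..T, inner ℝ (-(stdJ n (deriv z t))) (z t)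

end SymplecticPolytope

/-! The problem is an isoperimetric inequality in disguise. For a curve leading from a point `x` to
`Ψ x`, compare twice its action with its cost, the integral of the support function of `K` at `-J
ż`. A characteristic has `-J ż` in the normal cone at `z`, so that support function equals `⟨-J ż,
z⟩` and the cost is itself twice the action, `W`. If twice the action is at most `m` times the
squared cost for all admissible curves, then `W ≤ m W²`, so a positive action is at least `1 /
(2m)`.

The sharp `m` comes from a finite-dimensional problem. Among polygons with edges along the `J ν i`,
two parallel edges can be merged without lowering the action (`pathSum_merge`), so each direction is
needed only once. That leaves finitely many orders and, at fixed cost, a compact set of weights,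
hence a maximiser (`exists_pathSum_max`). Its bound passes to arbitrary polygons, because an edge
vector is a nonnegative combination of facet normals of no larger cost (`exists_nonneg_combination`,
`pathSum_split`), and then to absolutely continuous curves by inscribed polygons
(`integral_inner_le_of_normal`).

Equality must be turned into a characteristic. If no translate of the maximiser by a fixed vector of
`Ψ` had its vertices in `m K`, a separating functional would supply small edges whose insertion
raises the action by more than the cost allows (`exists_translate_mem_smul`). So a translate scaled
by `1 / m` lies in `K`; since its action attains the bound, each edge must lie in the facet whose
normal it uses (`exists_minimal_polygon`). Parametrised by cost, it is a characteristic of action `1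
/ (2m)`. Using each normal at most once gives the bound on discontinuities and the connectedness
statements. -/

section PathSum

/-! ### Action of polygons: merging, splitting and variation. -/

variable {E : Type*} [NormedAddCommGroup E] [InnerProductSpace ℝ E]

/-- Twice the action of the polygon that starts at `x` and has the successive edges `J y`,
`y ∈ L`. -/
noncomputable def pathSum (J : E →L[ℝ] E) : E → List E → ℝ
  | _, [] => 0
  | x, y :: L => inner ℝ y x + pathSum J (x + J y) L

variable {J : E →L[ℝ] E}

theorem pathSum_append (x : E) (L M : List E) :
    pathSum J x (L ++ M) = pathSum J x L + pathSum J (x + J L.sum) M := by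
  induction L generalizing x with
  | nil => simp [pathSum]
  | cons y L ih => simp [pathSum, ih, add_assoc]

theorem pathSum_add_left (x a : E) (L : List E) :
    pathSum J (x + a) L = pathSum J x L + inner ℝ L.sum a := by
  induction L generalizing x with
  | nil => simp [pathSum]
  | cons y L ih =>
    have : x + a + J y = x + J y + a := by abel
    simp only [pathSum, this, ih, inner_add_right, List.sum_cons, inner_add_left]
    ring

theorem pathSum_smul (r : ℝ) (x : E) (L : List E) :
    pathSum J (r • x) (L.map (r • ·)) = r ^ 2 * pathSum J x L := by
  induction L generalizing x with
  | nil => simp [pathSum]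
  | cons y L ih =>
    have : r • x + J (r • y) = r • (x + J y) := by simp
    simp only [pathSum, this, ih, List.map_cons, inner_smul_left, inner_smul_right]
    simp
    ring

theorem inner_self_apply_eq_zero (hJ : ∀ x y, inner ℝ (J x) y = -inner ℝ x (J y)) (y : E) :
    inner ℝ y (J y) = 0 := by
  have := hJ y y
  rw [real_inner_comm] at this
  linarith

/-- Two parallel edges can be merged into one without decreasing the action. -/
theorem pathSum_merge (hJ : ∀ x y, inner ℝ (J x) y = -inner ℝ x (J y)) (x v : E) (A B : List E)
    {a b : ℝ} (ha : 0 ≤ a) (hb : 0 ≤ b) :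
    pathSum J x (a • v :: (A ++ b • v :: B)) ≤ pathSum J x ((a + b) • v :: (A ++ B)) ∨
    pathSum J x (a • v :: (A ++ b • v :: B)) ≤ pathSum J x (A ++ (a + b) • v :: B) := by
  have e1 : x + J (a • v) + J A.sum + J (b • v) = x + (a + b) • J v + J A.sum := by
    simp [add_smul]; abel
  have e2 : x + J ((a + b) • v) + J A.sum = x + (a + b) • J v + J A.sum := by simp
  have e3 : x + J A.sum + J ((a + b) • v) = x + (a + b) • J v + J A.sum := by
    simp; abel
  have hv := inner_self_apply_eq_zero hJ v
  have hs : inner ℝ v (J A.sum) = -inner ℝ A.sum (J v) := by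
    have := hJ v A.sum
    rw [real_inner_comm] at this
    linarith
  simp only [pathSum, pathSum_append, e1, e2, e3, pathSum_add_left x _ A]
  simp only [map_smul, inner_add_right, inner_smul_left, inner_smul_right, hv, hs, conj_trivial]
  -- With `s = ⟨A.sum, J v⟩`, merging at the front changes the sum by `2 b s` and merging at the
  -- back by `-2 a s`; one of the two is nonnegative.
  rcases le_total 0 (inner ℝ A.sum (J v)) with h | h
  · left
    nlinarith
  · right
    nlinarith

/-- An edge can be replaced by two edges with the same sum, in a suitable order, without
decreasing the action. -/
theorem pathSum_split (hJ : ∀ x y, inner ℝ (J x) y = -inner ℝ x (J y)) (x u v : E)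
    (A B : List E) :
    pathSum J x (A ++ (u + v) :: B) ≤ pathSum J x (A ++ u :: v :: B) ∨
    pathSum J x (A ++ (u + v) :: B) ≤ pathSum J x (A ++ v :: u :: B) := by
  have hs : inner ℝ v (J u) = -inner ℝ u (J v) := by
    have := hJ v u
    rw [real_inner_comm] at this
    linarith
  have e1 (z : E) : z + J u + J v = z + J (u + v) := by simp; abel
  have e2 (z : E) : z + J v + J u = z + J (u + v) := by simp; abel
  simp only [pathSum, pathSum_append, e1, e2]
  simp only [inner_add_left, inner_add_right, hs]
  -- The two orders change the sum by `∓⟨u, J v⟩`, the signed area of the triangle that is added.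
  rcases le_total 0 (inner ℝ u (J v)) with h | h
  · right
    linarith
  · left
    linarith

/-- The action of a polygon with `x + J Y = Ψ x` depends on its edges only. -/
theorem pathSum_congr_start {Ψ : E →L[ℝ] E} (hJ2 : ∀ x, J (J x) = -x)
    (hΨ : ∀ x y, inner ℝ (J (Ψ x)) (Ψ y) = inner ℝ (J x) y)
    {x x' : E} {L : List E} (hx : x + J L.sum = Ψ x) (hx' : x' + J L.sum = Ψ x') :
    pathSum J x L = pathSum J x' L := by
  -- Two admissible starting points differ by a fixed vector of `Ψ`, and the edge sum is orthogonal
  -- to fixed vectors because `Ψ` is symplectic.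
  have h1 : Ψ (x - x') = x - x' := by
    rw [map_sub, ← hx, ← hx']; abel
  have h2 : inner ℝ L.sum (x - x') = 0 := by
    have h3 : L.sum = -J (Ψ x' - x') := by
      rw [← hx', add_sub_cancel_left, hJ2, neg_neg]
    have h4 := hΨ x' (x - x')
    rw [h1] at h4
    rw [h3, map_sub, inner_neg_left, inner_sub_left, h4, sub_self, neg_zero]
  have := pathSum_add_left (J := J) x' (x - x') L
  rw [add_sub_cancel, h2, add_zero] at this
  exact this

/-- The sum of the inner products of the vectors `p.1` with the vertices `x` of the polygon with
edges `J p.2` to which they are attached. -/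
noncomputable def vertexSum (J : E →L[ℝ] E) : E → List (E × E) → ℝ
  | _, [] => 0
  | x, p :: P => inner ℝ p.1 x + vertexSum J (x + J p.2) P

theorem vertexSum_ofFn {k : ℕ} (x : E) (y v : Fin k → E) :
    vertexSum J x (List.ofFn fun j => (y j, v j)) =
      ∑ j, inner ℝ (y j) (x + J (∑ i ∈ Finset.univ.filter (· < j), v i)) := by
  induction k generalizing x with
  | zero => simp [vertexSum]
  | succ k ih =>
    rw [List.ofFn_succ, vertexSum, ih, Fin.sum_univ_succ]
    congr 1
    · simp
    · refine Finset.sum_congr rfl fun j _ => ?_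
      simp [Finset.sum_filter, Fin.sum_univ_succ, add_assoc]

theorem pathSum_ofFn {k : ℕ} (x : E) (v : Fin k → E) :
    pathSum J x (List.ofFn v) =
      ∑ j, inner ℝ (v j) (x + J (∑ i ∈ Finset.univ.filter (· < j), v i)) := by
  rw [← vertexSum_ofFn]
  have : List.ofFn (fun j => (v j, v j)) = (List.ofFn v).map fun y => (y, y) := by
    rw [List.map_ofFn]
    rfl
  rw [this]
  generalize List.ofFn v = L
  induction L generalizing x with
  | nil => rfl
  | cons y L ih => simp only [pathSum, List.map_cons, vertexSum, ih]

/-- First and second variation of the action under the insertion of the small edges `ε • J p.1`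
before the edges `J p.2`. -/
theorem exists_pathSum_insert_eq (hJ : ∀ x y, inner ℝ (J x) y = -inner ℝ x (J y))
    (hJ2 : ∀ x, J (J x) = -x) (x a : E) (P : List (E × E)) :
    ∃ R : ℝ, ∀ ε : ℝ,
      pathSum J (x + ε • a) (P.flatMap fun p => [ε • p.1, p.2]) =
        pathSum J x (P.map Prod.snd) +
          ε * (2 * vertexSum J x P + inner ℝ (J x) a
            - inner ℝ (J (x + J (P.map Prod.snd).sum)) (a + J (P.map Prod.fst).sum))
          + ε ^ 2 * R := by
  induction P generalizing x a with
  | nil => exact ⟨0, by simp [pathSum, vertexSum]⟩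
  | cons p P ih =>
    obtain ⟨y, v⟩ := p
    -- The displacement `a` is kept general because it accumulates the inserted edges passed so far.
    obtain ⟨R, hR⟩ := ih (x + J v) (a + J y)
    refine ⟨R + inner ℝ y a, fun ε => ?_⟩
    have e : x + ε • a + J (ε • y) + J v = x + J v + ε • (a + J y) := by
      simp; abel
    have h1 : inner ℝ (J x) (J y) = inner ℝ y x := by rw [hJ, hJ2, inner_neg_right, neg_neg,
      real_inner_comm]
    simp only [List.flatMap_cons, List.cons_append, List.nil_append, pathSum, e, hR,
      List.map_cons, List.sum_cons, vertexSum]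
    simp only [map_add, map_smul, hJ2, inner_add_left, inner_neg_left,
      inner_add_right, inner_smul_left, inner_smul_right, conj_trivial, h1]
    ring

end PathSum

/-! ### Existence of a maximising polygon with edges in given directions. -/

section WeightedPath

variable {E : Type*} [NormedAddCommGroup E] [InnerProductSpace ℝ E] {ι : Type*}

/-- The list of vectors `b • ν i`, for the `(i, b)` in a list of weighted indices. -/
def weightedSteps (ν : ι → E) (L : List (ι × ℝ)) : List E := L.map fun p => p.2 • ν p.1

/-- The total cost of a list of weighted indices `(i, b)` at the unit prices `h i`. -/
def totalCost (h : ι → ℝ) (L : List (ι × ℝ)) : ℝ := (L.map fun p => p.2 * h p.1).sum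

variable {J : E →L[ℝ] E} (ν : ι → E) (h : ι → ℝ)

/-- A list of weighted indices can be rearranged into one without repeated indices, without
decreasing the action. -/
theorem exists_nodup_pathSum_le (hJ : ∀ x y, inner ℝ (J x) y = -inner ℝ x (J y))
    (x : E) (L : List (ι × ℝ)) (hL : ∀ p ∈ L, 0 ≤ p.2) :
    ∃ L' : List (ι × ℝ), (L'.map Prod.fst).Nodup ∧ (∀ p ∈ L', 0 ≤ p.2) ∧
      (∀ i, i ∈ L'.map Prod.fst ↔ i ∈ L.map Prod.fst) ∧
      (weightedSteps ν L').sum = (weightedSteps ν L).sum ∧ totalCost h L' = totalCost h L ∧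
      pathSum J x (weightedSteps ν L) ≤ pathSum J x (weightedSteps ν L') := by
  induction L generalizing x with
  | nil => exact ⟨[], by simp⟩
  | cons q L ih =>
    obtain ⟨i, a⟩ := q
    have ha : 0 ≤ a := hL (i, a) (by simp)
    obtain ⟨L', hn, h0, hk, hs, hc, hle⟩ := ih (x + J (a • ν i)) fun p hp => hL p (by simp [hp])
    have hle' : pathSum J x (weightedSteps ν ((i, a) :: L)) ≤
        pathSum J x (weightedSteps ν ((i, a) :: L')) := by
      simpa [weightedSteps, pathSum] using hle
    have hs' : (weightedSteps ν ((i, a) :: L')).sum = (weightedSteps ν ((i, a) :: L)).sum := by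
      simpa [weightedSteps] using hs
    have hc' : totalCost h ((i, a) :: L') = totalCost h ((i, a) :: L) := by
      simpa [totalCost] using hc
    by_cases hi : i ∈ L'.map Prod.fst
    · obtain ⟨⟨i', b⟩, hib, rfl⟩ := List.mem_map.1 hi
      obtain ⟨A, B, rfl⟩ := List.append_of_mem hib
      have hb : 0 ≤ b := h0 _ hib
      have hki : ∀ j, j ∈ ((i', a) :: L).map Prod.fst ↔
          j = i' ∨ j ∈ A.map Prod.fst ∨ j ∈ B.map Prod.fst := by
        intro j
        rw [List.map_cons, List.mem_cons, ← hk j]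
        simp only [List.map_append, List.map_cons, List.mem_append, List.mem_cons]
        tauto
      rw [List.map_append, List.map_cons] at hn
      have key := pathSum_merge hJ x (ν i') (weightedSteps ν A) (weightedSteps ν B) ha hb
      rcases key with key | key
      · refine ⟨(i', a + b) :: (A ++ B), ?_, ?_, ?_, ?_, ?_, ?_⟩
        · rw [List.map_cons, List.map_append]
          exact List.nodup_middle.1 hn
        · intro p hp
          rcases List.mem_cons.1 hp with rfl | hp
          · exact add_nonneg ha hb
          · refine h0 p ?_
            simp only [List.mem_append, List.mem_cons] at hp ⊢
            tauto
        · intro j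
          rw [hki]
          simp only [List.map_append, List.map_cons, List.mem_append, List.mem_cons]
        · rw [← hs']
          simp [weightedSteps, add_smul]
          abel
        · rw [← hc']
          simp [totalCost, add_mul]
          ring
        · refine hle'.trans ?_
          simpa [weightedSteps] using key
      · refine ⟨A ++ (i', a + b) :: B, ?_, ?_, ?_, ?_, ?_, ?_⟩
        · rwa [List.map_append, List.map_cons]
        · intro p hp
          rw [List.mem_append, List.mem_cons] at hp
          rcases hp with hp | rfl | hp
          · exact h0 p (by simp [hp])
          · exact add_nonneg ha hb
          · exact h0 p (by simp [hp])
        · intro j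
          rw [hki]
          simp only [List.map_append, List.map_cons, List.mem_append, List.mem_cons]
          tauto
        · rw [← hs']
          simp [weightedSteps, add_smul]
          abel
        · rw [← hc']
          simp [totalCost, add_mul]
          ring
        · refine hle'.trans ?_
          simpa [weightedSteps] using key
    · refine ⟨(i, a) :: L', ?_, ?_, ?_, hs', hc', hle'⟩
      · simpa using ⟨by simpa using hi, hn⟩
      · intro p hp
        rcases List.mem_cons.1 hp with rfl | hp
        · exact ha
        · exact h0 p hp
      · intro j
        rw [List.map_cons, List.map_cons, List.mem_cons, List.mem_cons, hk]

theorem exists_eq_map_of_nodup [DecidableEq ι] (L : List (ι × ℝ)) (hL : (L.map Prod.fst).Nodup) :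
    ∃ β : ι → ℝ, L = (L.map Prod.fst).map fun i => (i, β i) := by
  induction L with
  | nil => exact ⟨0, rfl⟩
  | cons p L ih =>
    rw [List.map_cons, List.nodup_cons] at hL
    obtain ⟨β, hβ⟩ := ih hL.2
    refine ⟨Function.update β p.1 p.2, ?_⟩
    rw [List.map_cons, List.map_cons, Function.update_self]
    congr 1
    conv_lhs => rw [hβ]
    refine List.map_congr_left fun i hi => ?_
    rw [Function.update_of_ne]
    rintro rfl
    exact hL.1 hi

theorem pathSum_filter_ne_zero (x : E) (L : List (ι × ℝ)) :
    pathSum J x (weightedSteps ν (L.filter fun p => p.2 ≠ 0)) = pathSum J x (weightedSteps ν L) ∧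
    (weightedSteps ν (L.filter fun p => p.2 ≠ 0)).sum = (weightedSteps ν L).sum ∧
    totalCost h (L.filter fun p => p.2 ≠ 0) = totalCost h L := by
  induction L generalizing x with
  | nil => simp
  | cons p L ih =>
    obtain ⟨h1, h2, h3⟩ := ih (x + J (p.2 • ν p.1))
    by_cases hp : p.2 = 0
    · rw [List.filter_cons_of_neg (by simpa using hp)]
      simp only [hp, zero_smul, map_zero, add_zero] at h1
      refine ⟨h1.trans ?_, h2.trans ?_, h3.trans ?_⟩ <;>
        simp [weightedSteps, totalCost, pathSum, hp]
    · rw [List.filter_cons_of_pos (by simpa using hp)]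
      simp only [weightedSteps, totalCost, List.map_cons, List.sum_cons, pathSum] at h1 h2 h3 ⊢
      exact ⟨by rw [h1], by rw [h2], by rw [h3]⟩

theorem continuous_pathSum {X : Type*} [TopologicalSpace X] (x : X → E) (hx : Continuous x)
    (l : List ι) (v : ι → X → E) (hv : ∀ i, Continuous (v i)) :
    Continuous fun t => pathSum J (x t) (l.map fun i => v i t) := by
  induction l generalizing x with
  | nil => exact continuous_const
  | cons i l ih =>
    simp only [List.map_cons, pathSum]
    exact ((hv i).inner hx).add (ih _ (hx.add (J.continuous.comp (hv i))))

theorem LinearMap.exists_apply_apply_eq {V W : Type*} [AddCommGroup V] [Module ℝ V]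
    [AddCommGroup W] [Module ℝ W] (f : V →ₗ[ℝ] W) :
    ∃ g : W →ₗ[ℝ] V, ∀ y ∈ LinearMap.range f, f (g y) = y := by
  obtain ⟨g, hg⟩ := f.rangeRestrict.exists_rightInverse_of_surjective
    (LinearMap.range_rangeRestrict f)
  obtain ⟨g', hg'⟩ := g.exists_extend
  refine ⟨g', fun y hy => ?_⟩
  have h1 := LinearMap.congr_fun hg ⟨y, hy⟩
  have h2 := LinearMap.congr_fun hg' ⟨y, hy⟩
  simp only [LinearMap.comp_apply, LinearMap.id_apply, Submodule.subtype_apply] at h1 h2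
  rw [h2]
  simpa using congrArg Subtype.val h1

/-- There is a list of weighted indices without repetition whose action is maximal, relative to
the square of its cost, among the lists that lead from some `x` to `Ψ x`. -/
theorem exists_pathSum_max [FiniteDimensional ℝ E] [Fintype ι] {Ψ : E →L[ℝ] E}
    (hJ : ∀ x y, inner ℝ (J x) y = -inner ℝ x (J y))
    (hJ2 : ∀ x, J (J x) = -x) (hΨ : ∀ x y, inner ℝ (J (Ψ x)) (Ψ y) = inner ℝ (J x) y)
    (hh : ∀ i, 0 < h i) {x₀ : E} {L₀ : List (ι × ℝ)}
    (hL₀ : ∀ p ∈ L₀, 0 ≤ p.2) (hx₀ : x₀ + J (weightedSteps ν L₀).sum = Ψ x₀)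
    (hpos : 0 < pathSum J x₀ (weightedSteps ν L₀)) :
    ∃ (x : E) (L : List (ι × ℝ)), (L.map Prod.fst).Nodup ∧ (∀ p ∈ L, 0 < p.2) ∧
      x + J (weightedSteps ν L).sum = Ψ x ∧ totalCost h L = 1 ∧
      0 < pathSum J x (weightedSteps ν L) ∧
      ∀ (x' : E) (L' : List (ι × ℝ)), (∀ p ∈ L', 0 ≤ p.2) →
        x' + J (weightedSteps ν L').sum = Ψ x' →
        pathSum J x' (weightedSteps ν L') ≤
          pathSum J x (weightedSteps ν L) * totalCost h L' ^ 2 := by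
  classical
  -- A linear section of `Ψ - 1` on its range makes the starting point depend continuously on the
  -- weights. By `pathSum_congr_start`, which section is chosen does not matter.
  obtain ⟨g, hg⟩ := LinearMap.exists_apply_apply_eq
    ((Ψ - ContinuousLinearMap.id ℝ E : E →L[ℝ] E) : E →ₗ[ℝ] E)
  set R : Submodule ℝ E :=
    LinearMap.range ((Ψ - ContinuousLinearMap.id ℝ E : E →L[ℝ] E) : E →ₗ[ℝ] E) with hR
  have hmem : ∀ {x y : E}, x + J y = Ψ x → J y ∈ R := by
    intro x y hxy
    refine ⟨x, ?_⟩
    simp [← hxy]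
  have hclosed : ∀ {y : E}, J y ∈ R → g (J y) + J y = Ψ (g (J y)) := by
    intro y hy
    have := hg _ hy
    simp only [ContinuousLinearMap.coe_coe, sub_apply,
      ContinuousLinearMap.id_apply] at this
    exact (eq_add_of_sub_eq' this).symm
  let Y : (ι → ℝ) → E := fun β => ∑ i, β i • ν i
  let f : List ι → (ι → ℝ) → ℝ := fun l β => pathSum J (g (J (Y β))) (l.map fun i => β i • ν i)
  let D : Set (ι → ℝ) := {β | (∀ i, 0 ≤ β i) ∧ ∑ i, β i * h i = 1 ∧ J (Y β) ∈ R}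
  have hYc : Continuous Y := by fun_prop
  have hfc : ∀ l, Continuous (f l) := fun l =>
    continuous_pathSum _ (g.continuous_of_finiteDimensional.comp (J.continuous.comp hYc)) l _
      fun i => by fun_prop
  have hDc : IsCompact D := by
    refine IsCompact.of_isClosed_subset (isCompact_Icc (a := (0 : ι → ℝ)) (b := fun i => 1 / h i))
      ?_ ?_
    · have h1 : IsClosed {β : ι → ℝ | ∀ i, 0 ≤ β i} := by
        simp only [Set.ofPred_forall]
        exact isClosed_iInter fun i => isClosed_le continuous_const (continuous_apply i)
      have h2 : IsClosed {β : ι → ℝ | ∑ i, β i * h i = 1} :=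
        isClosed_eq (by fun_prop) continuous_const
      have h3 : IsClosed {β : ι → ℝ | J (Y β) ∈ R} :=
        R.closed_of_finiteDimensional.preimage (J.continuous.comp hYc)
      exact h1.inter (h2.inter h3)
    · rintro β ⟨h1, h2, -⟩
      refine ⟨h1, fun i => ?_⟩
      rw [le_div_iff₀ (hh i), ← h2]
      exact Finset.single_le_sum (f := fun i => β i * h i)
        (fun j _ => mul_nonneg (h1 j) (hh j).le) (Finset.mem_univ i)
  have hlist : ∀ (l : List ι), l.Nodup → (∀ i, i ∈ l) → ∀ β : ι → ℝ,
      (weightedSteps ν (l.map fun i => (i, β i))).sum = Y β ∧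
      totalCost h (l.map fun i => (i, β i)) = ∑ i, β i * h i ∧
      weightedSteps ν (l.map fun i => (i, β i)) = l.map fun i => β i • ν i := by
    intro l hl hi β
    have hu : l.toFinset = Finset.univ := by ext i; simp [hi i]
    refine ⟨?_, ?_, ?_⟩
    · simp only [weightedSteps, List.map_map, Function.comp_def, Y]
      rw [← hu, List.sum_toFinset _ hl]
    · simp only [totalCost, List.map_map, Function.comp_def]
      rw [← hu, List.sum_toFinset _ hl]
    · simp [weightedSteps, Function.comp_def]
  -- Every admissible list is dominated by an ordering of all of `ι` with weights, of the same cost.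
  have hred : ∀ (x' : E) (L' : List (ι × ℝ)), (∀ p ∈ L', 0 ≤ p.2) →
      x' + J (weightedSteps ν L').sum = Ψ x' →
      ∃ (l : List ι) (β : ι → ℝ), l.Nodup ∧ (∀ i, i ∈ l) ∧ (∀ i, 0 ≤ β i) ∧ J (Y β) ∈ R ∧
        totalCost h L' = ∑ i, β i * h i ∧ pathSum J x' (weightedSteps ν L') ≤ f l β := by
    intro x' L' h0 hx'
    -- Zero-weight copies of all indices are appended so that, after merging, every index occurs
    -- exactly once and all orderings share the domain `D`.
    let Z : List (ι × ℝ) := Finset.univ.toList.map fun i => (i, 0)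
    obtain ⟨e1, e2, e3⟩ := hlist Finset.univ.toList (Finset.nodup_toList _) (by simp) 0
    have z0 : ∀ (x : E) (l : List ι), pathSum J x (l.map fun i => (0 : ℝ) • ν i) = 0 := by
      intro x l
      induction l generalizing x with
      | nil => rfl
      | cons i l ih => simpa [pathSum] using ih x
    have w : weightedSteps ν (L' ++ Z) = weightedSteps ν L' ++ weightedSteps ν Z :=
      List.map_append
    have eZ : (weightedSteps ν Z).sum = 0 := e1.trans (by simp [Y])
    have cZ : totalCost h Z = 0 := e2.trans (by simp)
    obtain ⟨L, hn, hp, hk, hs, hc, hle⟩ := exists_nodup_pathSum_le ν h hJ x' (L' ++ Z) (by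
      intro p hp
      rcases List.mem_append.1 hp with hp | hp
      · exact h0 p hp
      · obtain ⟨i, -, rfl⟩ := List.mem_map.1 hp
        exact le_rfl)
    have hall : ∀ i, i ∈ L.map Prod.fst := by
      intro i
      rw [hk, List.map_append, List.mem_append]
      right
      simp [Z]
    obtain ⟨β, hβ⟩ := exists_eq_map_of_nodup L hn
    obtain ⟨s1, s2, s3⟩ := hlist _ hn hall β
    rw [← hβ] at s1 s2 s3
    have hsum : (weightedSteps ν L').sum = Y β := by
      rw [← s1, hs, w, List.sum_append, eZ, add_zero]
    have hR' : J (Y β) ∈ R := hmem (hsum ▸ hx')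
    refine ⟨L.map Prod.fst, β, hn, hall, ?_, hR', ?_, ?_⟩
    · intro i
      have hi := hall i
      have : (i, β i) ∈ L := by
        rw [hβ]
        exact List.mem_map.2 ⟨i, hi, rfl⟩
      exact hp _ this
    · rw [← s2, hc]
      simp only [totalCost, List.map_append, List.sum_append] at cZ ⊢
      rw [cZ, add_zero]
    · have h1 : pathSum J x' (weightedSteps ν L') ≤ pathSum J x' (weightedSteps ν L) := by
        refine le_trans (le_of_eq ?_) hle
        rw [w, pathSum_append, show weightedSteps ν Z = _ from e3]
        simp only [Pi.zero_apply, z0, add_zero]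
      refine h1.trans (le_of_eq ?_)
      simp only [f]
      rw [← s3]
      refine pathSum_congr_start (Ψ := Ψ) hJ2 hΨ ?_ ?_
      · rw [s1, ← hsum, hx']
      · rw [s1]
        exact hclosed hR'
  have hscale : ∀ (l : List ι) (r : ℝ) (β : ι → ℝ), f l (r • β) = r ^ 2 * f l β := by
    intro l r β
    have hY : Y (r • β) = r • Y β := by simp [Y, Finset.smul_sum, mul_smul]
    have := pathSum_smul (J := J) r (g (J (Y β))) (l.map fun i => β i • ν i)
    rw [← this]
    simp only [f, hY, map_smul, List.map_map, Function.comp_def, Pi.smul_apply, smul_eq_mul,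
      mul_smul]
  -- The action is quadratic in the weights and the cost linear, so only cost `1` matters; cost `0`
  -- forces all weights to vanish.
  have hnorm : ∀ (l : List ι) (β : ι → ℝ), (∀ i, 0 ≤ β i) → J (Y β) ∈ R →
      f l β = 0 ∨ ∃ β' ∈ D, f l β = (∑ i, β i * h i) ^ 2 * f l β' := by
    intro l β h0 hR'
    have hc0 : 0 ≤ ∑ i, β i * h i := Finset.sum_nonneg fun i _ => mul_nonneg (h0 i) (hh i).le
    rcases hc0.eq_or_lt with hc | hc
    · left
      have : β = (0 : ℝ) • β := by
        ext i
        have := (Finset.sum_eq_zero_iff_of_nonneg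
          fun i _ => mul_nonneg (h0 i) (hh i).le).1 hc.symm i (Finset.mem_univ i)
        simpa [(hh i).ne'] using this
      rw [this, hscale]
      simp
    · right
      set c := ∑ i, β i * h i
      refine ⟨c⁻¹ • β, ⟨fun i => mul_nonneg (inv_nonneg.2 hc.le) (h0 i), ?_, ?_⟩, ?_⟩
      · simp only [Pi.smul_apply, smul_eq_mul, mul_assoc, ← Finset.mul_sum]
        exact inv_mul_cancel₀ hc.ne'
      · have hY : Y (c⁻¹ • β) = c⁻¹ • Y β := by simp [Y, Finset.smul_sum, mul_smul]
        rw [hY, map_smul]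
        exact R.smul_mem _ hR'
      · rw [hscale]
        field_simp
  obtain ⟨l₀, β₀, hn₀, hi₀, hβ₀, hR₀, -, hle₀⟩ := hred x₀ L₀ hL₀ hx₀
  have hfpos : 0 < f l₀ β₀ := hpos.trans_le hle₀
  obtain ⟨β₁, hβ₁, hf₁⟩ := (hnorm l₀ β₀ hβ₀ hR₀).resolve_left hfpos.ne'
  have hf₁pos : 0 < f l₀ β₁ := by
    rw [hf₁] at hfpos
    exact pos_of_mul_pos_right hfpos (sq_nonneg _)
  have hmax : ∀ l, ∃ β ∈ D, ∀ β' ∈ D, f l β' ≤ f l β := fun l =>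
    hDc.exists_isMaxOn ⟨β₁, hβ₁⟩ (hfc l).continuousOn
  choose b hbD hb using hmax
  -- One compact maximum per ordering, then a maximum over the finitely many orderings.
  have : Finite {l : List ι // l.Nodup ∧ ∀ i, i ∈ l} :=
    Finite.of_injective (β := {l : List ι // l.Nodup}) (fun l => ⟨l.1, l.2.1⟩) fun l l' e =>
      Subtype.ext (Subtype.mk.inj e)
  have : Nonempty {l : List ι // l.Nodup ∧ ∀ i, i ∈ l} := ⟨⟨l₀, hn₀, hi₀⟩⟩
  obtain ⟨⟨l, hln, hli⟩, hl⟩ := Finite.exists_max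
    (fun l : {l : List ι // l.Nodup ∧ ∀ i, i ∈ l} => f l.1 (b l.1))
  obtain ⟨s1, s2, s3⟩ := hlist l hln hli (b l)
  obtain ⟨q1, q2, q3⟩ := pathSum_filter_ne_zero (J := J) ν h (g (J (Y (b l))))
    (l.map fun i => (i, b l i))
  have hkeys : (l.map fun i => (i, b l i)).map Prod.fst = l := by simp [Function.comp_def]
  have hval : pathSum J (g (J (Y (b l))))
      (weightedSteps ν ((l.map fun i => (i, b l i)).filter fun p => p.2 ≠ 0)) = f l (b l) := by
    rw [q1, s3]
  have hmpos : 0 < f l (b l) :=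
    hf₁pos.trans_le ((hb l₀ β₁ hβ₁).trans (hl ⟨l₀, hn₀, hi₀⟩))
  refine ⟨g (J (Y (b l))), (l.map fun i => (i, b l i)).filter fun p => p.2 ≠ 0, ?_, ?_, ?_, ?_,
    ?_, ?_⟩
  · refine List.Nodup.sublist (List.filter_sublist.map _) ?_
    rwa [hkeys]
  · intro p hp
    rw [List.mem_filter] at hp
    obtain ⟨i, -, rfl⟩ := List.mem_map.1 hp.1
    exact lt_of_le_of_ne ((hbD l).1 i) (Ne.symm (by simpa using hp.2))
  · rw [q2, s1]
    exact hclosed (hbD l).2.2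
  · rw [q3, s2]
    exact (hbD l).2.1
  · rwa [hval]
  · intro x' L' h0 hx'
    obtain ⟨l', β', hn', hi', hβ', hR', hc', hle'⟩ := hred x' L' h0 hx'
    refine hle'.trans ?_
    rw [hval, hc']
    rcases hnorm l' β' hβ' hR' with h1 | ⟨β'', hβ'', h1⟩
    · rw [h1]
      positivity
    · rw [h1, mul_comm]
      exact mul_le_mul_of_nonneg_right ((hb l' β'' hβ'').trans (hl ⟨l', hn', hi'⟩)) (sq_nonneg _)

end WeightedPath

/-! ### Convexity of the relative interior. -/

section RelativeInterior

variable {E : Type*} [NormedAddCommGroup E] [NormedSpace ℝ E]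

theorem mem_intrinsicInterior_iff_exists_ball {s : Set E} {x : E} :
    x ∈ intrinsicInterior ℝ s ↔
      x ∈ s ∧ ∃ ε > 0, ∀ w ∈ affineSpan ℝ s, dist w x < ε → w ∈ s := by
  rw [mem_intrinsicInterior]
  constructor
  · rintro ⟨y, hy, rfl⟩
    refine ⟨mem_preimage.1 (interior_subset hy), ?_⟩
    rw [mem_interior_iff_mem_nhds, Metric.mem_nhds_iff] at hy
    obtain ⟨ε, hε, h⟩ := hy
    exact ⟨ε, hε, fun w hw hd => h (show (⟨w, hw⟩ : affineSpan ℝ s) ∈ Metric.ball y ε from hd)⟩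
  · rintro ⟨hx, ε, hε, h⟩
    refine ⟨⟨x, subset_affineSpan ℝ s hx⟩, ?_, rfl⟩
    rw [mem_interior_iff_mem_nhds, Metric.mem_nhds_iff]
    exact ⟨ε, hε, fun w hw => h w.1 w.2 hw⟩

/-- A small displacement of the convex combination along the affine span can be applied to both
endpoints instead. This serves to show that the times spent inside a facet form a convex set. -/
theorem Convex.intrinsicInterior_of_real {s : Set E} (hs : Convex ℝ s) :
    Convex ℝ (intrinsicInterior ℝ s) := by
  intro x hx y hy a b ha hb hab
  rw [mem_intrinsicInterior_iff_exists_ball] at hx hy ⊢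
  obtain ⟨hxs, ε, hε, hx⟩ := hx
  obtain ⟨hys, δ, hδ, hy⟩ := hy
  have hz : a • x + b • y ∈ s := hs hxs hys ha hb hab
  refine ⟨hz, min ε δ, lt_min hε hδ, fun w hw hd => ?_⟩
  have hdir : w - (a • x + b • y) ∈ (affineSpan ℝ s).direction :=
    AffineSubspace.vsub_mem_direction hw (subset_affineSpan ℝ s hz)
  set d := w - (a • x + b • y) with hdd
  rw [dist_eq_norm, ← hdd, lt_min_iff] at hd
  have h1 : d + x ∈ s := hx _ (AffineSubspace.vadd_mem_of_mem_direction hdir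
    (subset_affineSpan ℝ s hxs)) (by simpa [dist_eq_norm] using hd.1)
  have h2 : d + y ∈ s := hy _ (AffineSubspace.vadd_mem_of_mem_direction hdir
    (subset_affineSpan ℝ s hys)) (by simpa [dist_eq_norm] using hd.2)
  have h3 : w = a • (d + x) + b • (d + y) := by
    have : a • (d + x) + b • (d + y) = (a + b) • d + (a • x + b • y) := by module
    rw [this, hab, one_smul, hdd]
    abel
  rw [h3]
  exact hs h1 h2 ha hb hab

end RelativeInterior

/-! ### Linear programming duality for the facet inequalities. -/

section Duality

variable {E : Type*} [NormedAddCommGroup E] [InnerProductSpace ℝ E] [FiniteDimensional ℝ E]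
  {ι : Type*} [Fintype ι]

/-- A linear inequality that is valid on a convex body given by finitely many linear inequalities
is a nonnegative combination of these. -/
theorem exists_nonneg_combination {K : Set E} {ν : ι → E} {h : ι → ℝ} (hh : ∀ i, 0 < h i)
    (hK : K = {x | ∀ i, inner ℝ x (ν i) ≤ h i}) (h0 : (0 : E) ∈ interior K) {y : E} {c : ℝ}
    (hy : ∀ x ∈ K, inner ℝ x y ≤ c) :
    ∃ β : ι → ℝ, (∀ i, 0 ≤ β i) ∧ y = ∑ i, β i • ν i ∧ ∑ i, β i * h i ≤ c := by
  classical
  have hc : 0 ≤ c := by simpa using hy 0 (interior_subset h0)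
  -- For `c = 0` the ball in `K` around the origin forces `y = 0`; the scaling argument below needs
  -- `c > 0`.
  rcases hc.eq_or_lt with rfl | hc
  · refine ⟨0, by simp, ?_, by simp⟩
    obtain ⟨r, hr, hb⟩ := Metric.mem_nhds_iff.1 (mem_interior_iff_mem_nhds.1 h0)
    by_contra hne
    have hy0 : y ≠ 0 := by simpa using hne
    have hn : 0 < ‖y‖ := norm_pos_iff.2 hy0
    have h1 := hy ((r / 2 / ‖y‖) • y) (hb (by
      rw [mem_ball_zero_iff, norm_smul, Real.norm_of_nonneg (by positivity)]
      field_simp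
      linarith))
    rw [real_inner_smul_left, real_inner_self_eq_norm_sq] at h1
    have : 0 < r / 2 / ‖y‖ * ‖y‖ ^ 2 := by positivity
    linarith
  · let W : Set (ι → ℝ) := {w | (∀ i, 0 ≤ w i) ∧ ∑ i, w i * h i ≤ c}
    let T : (ι → ℝ) →ₗ[ℝ] E := ∑ i, (LinearMap.proj i).smulRight (ν i)
    have hT : ∀ w, T w = ∑ i, w i • ν i := fun w => by simp [T]
    have hWconv : Convex ℝ W := by
      rintro w ⟨h1, h2⟩ w' ⟨h3, h4⟩ a b ha hb hab
      refine ⟨fun i => add_nonneg (mul_nonneg ha (h1 i)) (mul_nonneg hb (h3 i)), ?_⟩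
      have : ∑ i, (a • w + b • w') i * h i = a * ∑ i, w i * h i + b * ∑ i, w' i * h i := by
        rw [Finset.mul_sum, Finset.mul_sum, ← Finset.sum_add_distrib]
        refine Finset.sum_congr rfl fun i _ => ?_
        simp
        ring
      rw [this]
      calc _ ≤ a * c + b * c := add_le_add (mul_le_mul_of_nonneg_left h2 ha)
            (mul_le_mul_of_nonneg_left h4 hb)
        _ = c := by rw [← add_mul, hab, one_mul]
    have hWc : IsCompact W := by
      refine IsCompact.of_isClosed_subset
        (isCompact_Icc (a := (0 : ι → ℝ)) (b := fun i => c / h i)) ?_ ?_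
      · have h1 : IsClosed {w : ι → ℝ | ∀ i, 0 ≤ w i} := by
          simp only [Set.ofPred_forall]
          exact isClosed_iInter fun i => isClosed_le continuous_const (continuous_apply i)
        have h2 : IsClosed {w : ι → ℝ | ∑ i, w i * h i ≤ c} :=
          isClosed_le (by fun_prop) continuous_const
        exact h1.inter h2
      · rintro w ⟨h1, h2⟩
        refine ⟨h1, fun i => ?_⟩
        rw [le_div_iff₀ (hh i)]
        exact (Finset.single_le_sum (f := fun i => w i * h i)
          (fun j _ => mul_nonneg (h1 j) (hh j).le) (Finset.mem_univ i)).trans h2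
    by_cases hmem : y ∈ T '' W
    · obtain ⟨w, hw, rfl⟩ := hmem
      exact ⟨w, hw.1, hT w, hw.2⟩
    · exfalso
      obtain ⟨f, u, hf, hfy⟩ := geometric_hahn_banach_closed_point (hWconv.linear_image T)
        (hWc.image T.continuous_of_finiteDimensional).isClosed hmem
      have hu : 0 < u := by
        simpa using hf (T 0) ⟨0, ⟨by simp, by simpa using hc.le⟩, rfl⟩
      set x := (InnerProductSpace.toDual ℝ E).symm f
      have hx : ∀ z, f z = inner ℝ x z := fun z =>
        (InnerProductSpace.toDual_symm_apply (𝕜 := ℝ)).symm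
      -- Evaluating the separating functional at the weights `c / h i` placed on a single index
      -- gives exactly the inequalities of `K`; this point then violates the hypothesis on `y`.
      have hxK : (c / u) • x ∈ K := by
        rw [hK]
        intro i
        have h1 := hf (T (Pi.single i (c / h i))) ⟨_, ⟨fun j => ?_, ?_⟩, rfl⟩
        · rw [hT, Finset.sum_eq_single i (fun j _ hj => by simp [hj]) (by simp), hx,
            Pi.single_eq_same, real_inner_smul_right] at h1
          rw [real_inner_smul_left]
          have := hh i
          rw [div_mul_eq_mul_div, div_lt_iff₀ this] at h1
          rw [div_mul_eq_mul_div, div_le_iff₀ hu]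
          linarith
        · by_cases hj : j = i
          · subst hj
            simpa using (div_pos hc (hh j)).le
          · simp [hj]
        · rw [Finset.sum_eq_single i (fun j _ hj => by simp [hj]) (by simp)]
          rw [Pi.single_eq_same, div_mul_cancel₀ _ (hh i).ne']
      have h2 := hy _ hxK
      rw [real_inner_smul_left, ← hx, div_mul_eq_mul_div, div_le_iff₀ hu] at h2
      nlinarith

end Duality

/-! ### Facets, outer normals and the facet description of a polytope. -/

namespace SymplecticPolytope

variable {n : ℕ} {K F : Set (Phase n)} {ν : Phase n}

theorem finrank_phase : Module.finrank ℝ (Phase n) = 2 * n := by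
  rw [finrank_euclideanSpace, Fintype.card_sum, Fintype.card_fin, two_mul]

theorem finrank_span_singleton_orthogonal {p : Phase n} (hp : p ≠ 0) :
    Module.finrank ℝ (ℝ ∙ p)ᗮ + 1 = 2 * n := by
  have := Submodule.finrank_add_finrank_orthogonal (ℝ ∙ p)
  rw [finrank_span_singleton hp, finrank_phase] at this
  omega

/-- Parity: an empty facet would give `1 = 2 * n`. -/
theorem IsFacet.nonempty (hF : IsFacet K F) : F.Nonempty := by
  by_contra hne
  rw [not_nonempty_iff_eq_empty] at hne
  have := hF.2
  rw [hne, vectorSpan_empty, finrank_bot] at this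
  omega

theorem vectorSpan_le_orthogonal {y : Phase n}
    (h : ∀ u ∈ F, ∀ x ∈ F, inner ℝ (u - x) y = 0) : vectorSpan ℝ F ≤ (ℝ ∙ y)ᗮ := by
  rw [vectorSpan_def, Submodule.span_le]
  rintro _ ⟨u, hu, x, hx, rfl⟩
  rw [SetLike.mem_coe, Submodule.mem_orthogonal_singleton_iff_inner_left]
  exact h u hu x hx

theorem IsUnitOuterNormal.inner_sub_eq_zero (hF : IsFacet K F) (hν : IsUnitOuterNormal K F ν) :
    ∀ u ∈ F, ∀ x ∈ F, inner ℝ (u - x) ν = 0 := by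
  intro u hu x hx
  have h1 := hν.2 x hx u (hF.1.subset hu)
  have h2 := hν.2 u hu x (hF.1.subset hx)
  rw [inner_sub_left] at *
  linarith

theorem IsUnitOuterNormal.ne_zero (hν : IsUnitOuterNormal K F ν) : ν ≠ 0 := by
  rintro rfl
  simpa using hν.1

theorem IsUnitOuterNormal.vectorSpan_eq (hF : IsFacet K F) (hν : IsUnitOuterNormal K F ν) :
    vectorSpan ℝ F = (ℝ ∙ ν)ᗮ := by
  refine Submodule.eq_of_le_of_finrank_eq
    (vectorSpan_le_orthogonal (hν.inner_sub_eq_zero hF)) ?_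
  have := finrank_span_singleton_orthogonal hν.ne_zero
  have := hF.2
  omega

theorem IsUnitOuterNormal.exists_eq_smul (hF : IsFacet K F) (hν : IsUnitOuterNormal K F ν)
    {y : Phase n} (h : ∀ u ∈ F, ∀ x ∈ F, inner ℝ (u - x) y = 0) : ∃ c : ℝ, y = c • ν := by
  have h1 := vectorSpan_le_orthogonal h
  rw [hν.vectorSpan_eq hF] at h1
  have h2 : (ℝ ∙ y) ≤ (ℝ ∙ ν) := by
    have := Submodule.orthogonal_le h1
    rwa [Submodule.orthogonal_orthogonal, Submodule.orthogonal_orthogonal] at this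
  obtain ⟨c, hc⟩ := Submodule.mem_span_singleton.1 (h2 (Submodule.mem_span_singleton_self y))
  exact ⟨c, hc.symm⟩

theorem IsUnitOuterNormal.inner_pos (h0 : (0 : Phase n) ∈ interior K)
    (hν : IsUnitOuterNormal K F ν) {x : Phase n} (hx : x ∈ F) : 0 < inner ℝ x ν := by
  obtain ⟨r, hr, hb⟩ := Metric.mem_nhds_iff.1 (mem_interior_iff_mem_nhds.1 h0)
  have h1 := hν.2 x hx ((r / 2) • ν) (hb (by
    rw [mem_ball_zero_iff, norm_smul, hν.1, Real.norm_of_nonneg (by positivity)]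
    linarith))
  rw [inner_sub_left, real_inner_smul_left, real_inner_self_eq_norm_sq, hν.1] at h1
  linarith

theorem nonneg_of_smul_mem_normalCone (h0 : (0 : Phase n) ∈ interior K)
    (hν : IsUnitOuterNormal K F ν) {x : Phase n} (hx : x ∈ F) {c : ℝ}
    (hc : c • ν ∈ normalCone K x) : 0 ≤ c := by
  have h1 := hc 0 (interior_subset h0)
  rw [zero_sub, inner_neg_left, real_inner_smul_right] at h1
  have := hν.inner_pos h0 hx
  by_contra hneg
  nlinarith

/-- The functional exposing `F` is constant on `F`, hence a multiple of `ν`, and nonnegative because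
the origin is interior. Thus the level set of `ν` in `K` through a point of `F` also maximises it.
-/
theorem IsUnitOuterNormal.eq_face (h0 : (0 : Phase n) ∈ interior K) (hF : IsFacet K F)
    (hν : IsUnitOuterNormal K F ν) {x₀ : Phase n} (hx₀ : x₀ ∈ F) :
    F = {x ∈ K | inner ℝ x ν = inner ℝ x₀ ν} := by
  obtain ⟨l, hl⟩ := hF.1 hF.nonempty
  set a := (InnerProductSpace.toDual ℝ (Phase n)).symm l
  have ha : ∀ z, l z = inner ℝ z a := fun z => by
    rw [real_inner_comm]
    exact (InnerProductSpace.toDual_symm_apply (𝕜 := ℝ)).symm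
  have hmem : ∀ x, x ∈ F ↔ x ∈ K ∧ ∀ y ∈ K, l y ≤ l x := fun x => by
    conv_lhs => rw [hl]
    rfl
  have hN : ∀ x ∈ F, a ∈ normalCone K x := by
    intro x hx u hu
    rw [inner_sub_left, ← ha, ← ha]
    linarith [((hmem x).1 hx).2 u hu]
  obtain ⟨c, hc⟩ := hν.exists_eq_smul hF (y := a) (by
    intro u hu x hx
    have h1 := hN x hx u (hF.1.subset hu)
    have h2 := hN u hu x (hF.1.subset hx)
    rw [inner_sub_left] at *
    linarith)
  have hc0 : 0 ≤ c := nonneg_of_smul_mem_normalCone h0 hν hx₀ (hc ▸ hN x₀ hx₀)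
  ext x
  constructor
  · intro hx
    refine ⟨hF.1.subset hx, ?_⟩
    have := hν.inner_sub_eq_zero hF x hx x₀ hx₀
    rw [inner_sub_left] at this
    linarith
  · rintro ⟨hxK, hx⟩
    rw [hmem]
    refine ⟨hxK, fun y hy => ?_⟩
    rw [ha, ha, hc, real_inner_smul_right, real_inner_smul_right, hx]
    have := hν.2 x₀ hx₀ y hy
    rw [inner_sub_left] at this
    exact mul_le_mul_of_nonneg_left (by linarith) hc0

/-- From a relatively interior point one can move slightly away from any `u ∈ F` and stay in `F`, so
the normal-cone inequality becomes an equality on `F`. -/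
theorem IsUnitOuterNormal.eq_smul_of_mem_normalCone (h0 : (0 : Phase n) ∈ interior K)
    (hF : IsFacet K F) (hν : IsUnitOuterNormal K F ν) {x y : Phase n}
    (hx : x ∈ intrinsicInterior ℝ F) (hy : y ∈ normalCone K x) :
    ∃ c : ℝ, 0 ≤ c ∧ y = c • ν := by
  rw [mem_intrinsicInterior_iff_exists_ball] at hx
  obtain ⟨hxF, ε, hε, hx⟩ := hx
  have key : ∀ u ∈ F, inner ℝ (u - x) y = 0 := by
    intro u hu
    refine le_antisymm (hy u (hF.1.subset hu)) ?_
    set t : ℝ := ε / (2 * (‖u - x‖ + 1)) with ht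
    have ht0 : 0 < t := by positivity
    have hw : x + t • (x - u) ∈ F := by
      refine hx _ ?_ ?_
      · have hd : t • (x - u) ∈ (affineSpan ℝ F).direction :=
          Submodule.smul_mem _ _ (AffineSubspace.vsub_mem_direction
            (subset_affineSpan ℝ F hxF) (subset_affineSpan ℝ F hu))
        have := AffineSubspace.vadd_mem_of_mem_direction hd (subset_affineSpan ℝ F hxF)
        rwa [vadd_eq_add, add_comm] at this
      · rw [dist_eq_norm, add_sub_cancel_left, norm_smul, Real.norm_of_nonneg ht0.le,
          norm_sub_rev, ht, div_mul_eq_mul_div, div_lt_iff₀ (by positivity)]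
        nlinarith [norm_nonneg (u - x)]
    have h1 := hy _ (hF.1.subset hw)
    rw [add_sub_cancel_left, real_inner_smul_left, ← neg_sub, inner_neg_left] at h1
    nlinarith
  obtain ⟨c, rfl⟩ := hν.exists_eq_smul hF (y := y) (by
    intro u hu v hv
    have h1 := key u hu
    have h2 := key v hv
    rw [inner_sub_left] at *
    linarith)
  exact ⟨c, nonneg_of_smul_mem_normalCone h0 hν hxF hy, rfl⟩

/-- A polytope with the origin in its interior is given by finitely many irredundant inequalities
`⟪x, p⟫ ≤ 1`. -/
theorem IsPolytope.exists_irredundant (hK : IsPolytope K) (h0 : (0 : Phase n) ∈ interior K) :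
    ∃ s : Finset (Phase n), K = {x | ∀ p ∈ s, inner ℝ x p ≤ 1} ∧
      ∀ p ∈ s, ∃ z : Phase n, (∀ q ∈ s, q ≠ p → inner ℝ z q ≤ 1) ∧ 1 < inner ℝ z p := by
  classical
  obtain ⟨-, s₀, hs₀⟩ := hK
  obtain ⟨r, hr, hb⟩ := Metric.mem_nhds_iff.1 (mem_interior_iff_mem_nhds.1 h0)
  have hc0 : ∀ p ∈ s₀, 0 ≤ p.2 := by
    intro p hp
    have := interior_subset h0
    rw [hs₀] at this
    simpa using this p hp
  have hcpos : ∀ p ∈ s₀, p.1 ≠ 0 → 0 < p.2 := by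
    intro p hp hne
    have hn : 0 < ‖p.1‖ := norm_pos_iff.2 hne
    have h1 : (r / 2 / ‖p.1‖) • p.1 ∈ K := hb (by
      rw [mem_ball_zero_iff, norm_smul, Real.norm_of_nonneg (by positivity)]
      field_simp
      linarith)
    rw [hs₀] at h1
    have h2 := h1 p hp
    rw [real_inner_smul_left, real_inner_self_eq_norm_sq] at h2
    have : 0 < r / 2 / ‖p.1‖ * ‖p.1‖ ^ 2 := by positivity
    linarith
  have hex : ∃ s : Finset (Phase n), K = {x | ∀ p ∈ s, inner ℝ x p ≤ 1} := by
    refine ⟨(s₀.filter fun p => p.1 ≠ 0).image fun p => p.2⁻¹ • p.1, ?_⟩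
    rw [hs₀]
    ext x
    simp only [mem_ofPred_eq, Finset.mem_image, Finset.mem_filter, forall_exists_index, and_imp]
    constructor
    · rintro h _ p hp hne rfl
      rw [real_inner_smul_right, inv_mul_le_iff₀ (hcpos p hp hne), mul_one]
      exact h p hp
    · intro h p hp
      by_cases hne : p.1 = 0
      · rw [hne, inner_zero_right]
        exact hc0 p hp
      · have := h _ p hp hne rfl
        rwa [real_inner_smul_right, inv_mul_le_iff₀ (hcpos p hp hne), mul_one] at this
  -- A description of minimal cardinality is irredundant: an inequality implied by the others could
  -- be erased.
  obtain ⟨s, hs, hmin⟩ := WellFounded.has_min (measure Finset.card).wf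
    {s : Finset (Phase n) | K = {x | ∀ p ∈ s, inner ℝ x p ≤ 1}} hex
  refine ⟨s, hs, fun p hp => ?_⟩
  by_contra hcon
  push Not at hcon
  refine hmin (s.erase p) ?_ (Finset.card_erase_lt_of_mem hp)
  have hs' : K = {x | ∀ p ∈ s, inner ℝ x p ≤ 1} := hs
  show K = _
  rw [hs']
  ext x
  constructor
  · intro h q hq
    exact h q (Finset.mem_of_mem_erase hq)
  · intro h q hq
    by_cases hqp : q = p
    · subst hqp
      exact hcon x fun q' hq' hne => h q' (Finset.mem_erase.2 ⟨hne, hq'⟩)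
    · exact h q (Finset.mem_erase.2 ⟨hqp, hq⟩)

/-- The point `z` violates only the inequality of `p`. Scaled back to the hyperplane `⟨x, p⟩ = 1`,
it satisfies all the others strictly, so small moves orthogonal to `p` remain in `K` and the face
spans a hyperplane. -/
theorem isFacet_of_irredundant {s : Finset (Phase n)}
    (hs : K = {x | ∀ p ∈ s, inner ℝ x p ≤ 1}) {p z : Phase n}
    (hps : p ∈ s) (hz : ∀ q ∈ s, q ≠ p → inner ℝ z q ≤ 1) (hzp : 1 < inner ℝ z p) :
    IsFacet K {x ∈ K | inner ℝ x p = 1} ∧ vectorSpan ℝ {x ∈ K | inner ℝ x p = 1} = (ℝ ∙ p)ᗮ := by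
  have hp : p ≠ 0 := by
    rintro rfl
    rw [inner_zero_right] at hzp
    linarith
  set G : Set (Phase n) := {x ∈ K | inner ℝ x p = 1} with hG
  have hspan : vectorSpan ℝ G = (ℝ ∙ p)ᗮ := by
    refine le_antisymm (vectorSpan_le_orthogonal ?_) ?_
    · rintro u ⟨-, hu⟩ x ⟨-, hx⟩
      rw [inner_sub_left, hu, hx, sub_self]
    · intro v hv
      rw [Submodule.mem_orthogonal_singleton_iff_inner_left] at hv
      set t := inner ℝ z p
      have ht : 0 < t := by linarith
      set w := t⁻¹ • z with hw
      have hwp : inner ℝ w p = 1 := by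
        rw [hw, real_inner_smul_left]
        exact inv_mul_cancel₀ ht.ne'
      have hwq : ∀ q ∈ s, q ≠ p → inner ℝ w q < 1 := by
        intro q hq hne
        rw [hw, real_inner_smul_left, inv_mul_lt_iff₀ ht, mul_one]
        exact (hz q hq hne).trans_lt hzp
      have hev : ∀ᶠ ε : ℝ in nhdsWithin 0 (Ioi 0), ∀ q ∈ s, inner ℝ (w + ε • v) q ≤ 1 := by
        rw [Filter.eventually_all_finset]
        intro q hq
        by_cases hne : q = p
        · refine Filter.Eventually.of_forall fun ε => ?_
          rw [hne, inner_add_left, hwp, real_inner_smul_left, hv]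
          simp
        · have hcont : Continuous fun ε : ℝ => inner ℝ (w + ε • v) q := by fun_prop
          have h1 : ∀ᶠ ε : ℝ in nhds 0, inner ℝ (w + ε • v) q < 1 :=
            hcont.continuousAt.eventually_lt continuousAt_const (by simpa using hwq q hq hne)
          exact (h1.filter_mono nhdsWithin_le_nhds).mono fun ε h => h.le
      obtain ⟨ε, hε, hε0⟩ := (hev.and self_mem_nhdsWithin).exists
      have hε0 : 0 < ε := hε0
      have hw1 : w ∈ G := by
        refine ⟨?_, hwp⟩
        rw [hs]
        intro q hq
        by_cases hne : q = p
        · rw [hne, hwp]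
        · exact (hwq q hq hne).le
      have hw2 : w + ε • v ∈ G := by
        refine ⟨?_, ?_⟩
        · rw [hs]
          exact hε
        · rw [inner_add_left, hwp, real_inner_smul_left, hv]
          simp
      have h3 := vsub_mem_vectorSpan ℝ hw2 hw1
      rw [vsub_eq_sub, add_sub_cancel_left] at h3
      have h4 := (vectorSpan ℝ G).smul_mem ε⁻¹ h3
      rwa [smul_smul, inv_mul_cancel₀ hε0.ne', one_smul] at h4
  refine ⟨⟨?_, ?_⟩, hspan⟩
  · rintro ⟨x₀, hx₀K, hx₀⟩
    refine ⟨InnerProductSpace.toDual ℝ (Phase n) p, ?_⟩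
    ext x
    simp only [hG, mem_ofPred_eq, InnerProductSpace.toDual_apply_apply, and_congr_right_iff]
    intro hxK
    have hle : ∀ y ∈ K, inner ℝ y p ≤ 1 := by
      intro y hy
      rw [hs] at hy
      exact hy p hps
    constructor
    · intro hx y hy
      rw [real_inner_comm y p, real_inner_comm x p, hx]
      exact hle y hy
    · intro h
      have := h x₀ hx₀K
      rw [real_inner_comm x₀ p, hx₀, real_inner_comm x p] at this
      exact le_antisymm (hle x hxK) this
  · rw [hspan]
    exact finrank_span_singleton_orthogonal hp

/-- A polytope is the intersection of the half-spaces of its facets. -/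
theorem IsFacetList.exists_support (hK : IsPolytope K) (h0 : (0 : Phase n) ∈ interior K)
    {N : ℕ} {F : Fin N → Set (Phase n)} {ν : Fin N → Phase n} (hF : IsFacetList K F ν) :
    ∃ h : Fin N → ℝ, (∀ i, 0 < h i) ∧ K = {x | ∀ i, inner ℝ x (ν i) ≤ h i} ∧
      ∀ i, F i = {x ∈ K | inner ℝ x (ν i) = h i} := by
  have hfac : ∀ i, IsFacet K (F i) := fun i => by
    have : F i ∈ range F := ⟨i, rfl⟩
    rwa [hF.range_eq] at this
  choose x₀ hx₀ using fun i => (hfac i).nonempty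
  refine ⟨fun i => inner ℝ (x₀ i) (ν i), fun i => (hF.normal i).inner_pos h0 (hx₀ i), ?_,
    fun i => (hF.normal i).eq_face h0 (hfac i) (hx₀ i)⟩
  obtain ⟨s, hs, hirr⟩ := hK.exists_irredundant h0
  apply Subset.antisymm
  · intro x hx i
    have := (hF.normal i).2 _ (hx₀ i) x hx
    rw [inner_sub_left] at this
    linarith
  · intro x hx
    rw [hs]
    intro p hp
    obtain ⟨z, hz, hzp⟩ := hirr p hp
    obtain ⟨hG, hspan⟩ := isFacet_of_irredundant hs hp hz hzp
    obtain ⟨i, hi⟩ : {x ∈ K | inner ℝ x p = 1} ∈ range F := by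
      rw [hF.range_eq]
      exact hG
    have hx₀i := hx₀ i
    have hconst : ∀ u ∈ F i, ∀ x ∈ F i, inner ℝ (u - x) p = 0 := by
      rw [hi]
      rintro u ⟨-, hu⟩ x ⟨-, hx⟩
      rw [inner_sub_left, hu, hx, sub_self]
    obtain ⟨c, rfl⟩ := (hF.normal i).exists_eq_smul (hfac i) hconst
    have hval : inner ℝ (x₀ i) (c • ν i) = 1 := by
      rw [hi] at hx₀i
      exact hx₀i.2
    rw [real_inner_smul_right] at hval ⊢
    have hpos := (hF.normal i).inner_pos h0 (hx₀ i)
    have hc : 0 ≤ c := by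
      by_contra hneg
      nlinarith
    rw [← hval]
    exact mul_le_mul_of_nonneg_left (hx i) hc

end SymplecticPolytope

/-! ### From facet directions to all polygons; first variation at a maximiser. -/

section Variation

variable {E : Type*} [NormedAddCommGroup E] [InnerProductSpace ℝ E] {ι : Type*}
  {J : E →L[ℝ] E} (ν : ι → E) (h : ι → ℝ)

theorem weightedSteps_append (L M : List (ι × ℝ)) :
    weightedSteps ν (L ++ M) = weightedSteps ν L ++ weightedSteps ν M :=
  List.map_append

theorem totalCost_append (L M : List (ι × ℝ)) :
    totalCost h (L ++ M) = totalCost h L + totalCost h M := by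
  simp [totalCost]

/-- An edge whose direction is a nonnegative combination can be replaced by the terms of the
combination, in a suitable order, without decreasing the action. -/
theorem exists_weightedSteps_sum (hJ : ∀ x y, inner ℝ (J x) y = -inner ℝ x (J y)) (s : Finset ι)
    {β : ι → ℝ} (hβ : ∀ i, 0 ≤ β i) (x : E) :
    ∃ L : List (ι × ℝ), (∀ p ∈ L, 0 ≤ p.2) ∧ (weightedSteps ν L).sum = ∑ i ∈ s, β i • ν i ∧
      totalCost h L = ∑ i ∈ s, β i * h i ∧
      pathSum J x [∑ i ∈ s, β i • ν i] ≤ pathSum J x (weightedSteps ν L) := by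
  classical
  induction s using Finset.induction_on generalizing x with
  | empty => exact ⟨[], by simp [weightedSteps, totalCost, pathSum]⟩
  | insert i s hi ih =>
    simp only [Finset.sum_insert hi]
    set y := ∑ i ∈ s, β i • ν i
    have e1 : weightedSteps ν [(i, β i)] = [β i • ν i] := rfl
    have e2 : totalCost h [(i, β i)] = β i * h i := by simp [totalCost]
    -- The favourable order decides whether the new term precedes or follows the rest, and so at
    -- which vertex the induction hypothesis is applied.
    rcases pathSum_split hJ x (β i • ν i) y [] [] with hle | hle
    · obtain ⟨L, h0, hs, hc, hL⟩ := ih (x + J (β i • ν i))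
      refine ⟨[(i, β i)] ++ L, ?_, ?_, ?_, ?_⟩
      · intro p hp
        rcases List.mem_append.1 hp with hp | hp
        · rw [List.mem_singleton.1 hp]
          exact hβ i
        · exact h0 p hp
      · rw [weightedSteps_append, List.sum_append, hs, e1, List.sum_singleton]
      · rw [totalCost_append, hc, e2]
      · refine hle.trans ?_
        rw [weightedSteps_append, e1]
        simp only [List.nil_append, List.cons_append, pathSum] at hL ⊢
        linarith
    · obtain ⟨L, h0, hs, hc, hL⟩ := ih x
      refine ⟨L ++ [(i, β i)], ?_, ?_, ?_, ?_⟩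
      · intro p hp
        rcases List.mem_append.1 hp with hp | hp
        · exact h0 p hp
        · rw [List.mem_singleton.1 hp]
          exact hβ i
      · rw [weightedSteps_append, List.sum_append, hs, e1, List.sum_singleton, add_comm]
      · rw [totalCost_append, hc, e2, add_comm]
      · refine hle.trans ?_
        rw [weightedSteps_append, e1, List.nil_append, pathSum_append, hs]
        simp only [pathSum] at hL ⊢
        linarith

variable {ν h}

/-- A polygon can be replaced by one with edges in finitely many given directions, without
decreasing the action and without increasing the cost. -/
theorem exists_weightedSteps_of_support [FiniteDimensional ℝ E] [Fintype ι]
    (hJ : ∀ x y, inner ℝ (J x) y = -inner ℝ x (J y)) {K : Set E} (hh : ∀ i, 0 < h i)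
    (hK : K = {x | ∀ i, inner ℝ x (ν i) ≤ h i}) (h0 : (0 : E) ∈ interior K)
    (x : E) (Q : List (E × ℝ)) (hQ : ∀ q ∈ Q, ∀ z ∈ K, inner ℝ z q.1 ≤ q.2) :
    ∃ L : List (ι × ℝ), (∀ p ∈ L, 0 ≤ p.2) ∧ (weightedSteps ν L).sum = (Q.map Prod.fst).sum ∧
      totalCost h L ≤ (Q.map Prod.snd).sum ∧
      pathSum J x (Q.map Prod.fst) ≤ pathSum J x (weightedSteps ν L) := by
  induction Q generalizing x with
  | nil => exact ⟨[], by simp [weightedSteps, totalCost]⟩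
  | cons q Q ih =>
    obtain ⟨y, c⟩ := q
    obtain ⟨β, hβ, rfl, hβc⟩ := exists_nonneg_combination hh hK h0 (hQ (y, c) (by simp))
    obtain ⟨L₁, p1, s1, c1, l1⟩ := exists_weightedSteps_sum ν h hJ Finset.univ hβ x
    obtain ⟨L₂, p2, s2, c2, l2⟩ := ih (x + J (∑ i, β i • ν i))
      fun q hq => hQ q (List.mem_cons_of_mem _ hq)
    refine ⟨L₁ ++ L₂, ?_, ?_, ?_, ?_⟩
    · intro p hp
      rcases List.mem_append.1 hp with hp | hp
      · exact p1 p hp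
      · exact p2 p hp
    · rw [weightedSteps_append, List.sum_append, s1, s2, List.map_cons, List.sum_cons]
    · rw [totalCost_append, List.map_cons, List.sum_cons, c1]
      exact add_le_add hβc c2
    · rw [weightedSteps_append, pathSum_append, s1]
      simp only [List.map_cons, pathSum] at l1 ⊢
      linarith

/-- A bound for the action of the polygons with edges in finitely many directions extends to all
polygons, with the support function as the cost of an edge. -/
theorem pathSum_le_of_support [FiniteDimensional ℝ E] [Fintype ι] {Ψ : E →L[ℝ] E}
    (hJ : ∀ x y, inner ℝ (J x) y = -inner ℝ x (J y)) {K : Set E} (hh : ∀ i, 0 < h i)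
    (hK : K = {x | ∀ i, inner ℝ x (ν i) ≤ h i}) (h0 : (0 : E) ∈ interior K) {m : ℝ} (hm : 0 ≤ m)
    (hmax : ∀ (x : E) (L : List (ι × ℝ)), (∀ p ∈ L, 0 ≤ p.2) →
      x + J (weightedSteps ν L).sum = Ψ x →
      pathSum J x (weightedSteps ν L) ≤ m * totalCost h L ^ 2)
    {x : E} {Q : List (E × ℝ)} (hQ : ∀ q ∈ Q, ∀ z ∈ K, inner ℝ z q.1 ≤ q.2)
    (hx : x + J (Q.map Prod.fst).sum = Ψ x) :
    pathSum J x (Q.map Prod.fst) ≤ m * (Q.map Prod.snd).sum ^ 2 := by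
  obtain ⟨L, hp, hs, hc, hle⟩ := exists_weightedSteps_of_support hJ hh hK h0 x Q hQ
  have hc0 : 0 ≤ totalCost h L := by
    refine List.sum_nonneg fun z hz => ?_
    obtain ⟨p, hpL, rfl⟩ := List.mem_map.1 hz
    exact mul_nonneg (hp p hpL) (hh _).le
  calc _ ≤ _ := hle
    _ ≤ _ := hmax x L hp (by rw [hs, hx])
    _ ≤ _ := by gcongr

/-- For a symplectic `Ψ`, the range of `Ψ - 1` is the image under `J` of the orthogonal complement
of the fixed vectors of `Ψ`. -/
theorem exists_add_eq_of_orthogonal_fixed [FiniteDimensional ℝ E] {Ψ : E →L[ℝ] E}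
    (hJ : ∀ x y, inner ℝ (J x) y = -inner ℝ x (J y)) (hJ2 : ∀ x, J (J x) = -x)
    (hΨ : ∀ x y, inner ℝ (J (Ψ x)) (Ψ y) = inner ℝ (J x) y) {y : E}
    (hy : ∀ e, Ψ e = e → inner ℝ y e = 0) : ∃ a, a + J y = Ψ a := by
  set R : Submodule ℝ E :=
    LinearMap.range ((Ψ - ContinuousLinearMap.id ℝ E : E →L[ℝ] E) : E →ₗ[ℝ] E)
  have hinj : Function.Injective (Ψ : E →ₗ[ℝ] E) := by
    rw [injective_iff_map_eq_zero]
    intro z hz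
    have hz : Ψ z = 0 := hz
    have h1 := hΨ z (J z)
    rw [hz, map_zero, inner_zero_left] at h1
    have h2 : J z = 0 := inner_self_eq_zero.1 h1.symm
    simpa [h2] using (hJ2 z).symm
  have hsurj : Function.Surjective Ψ := LinearMap.injective_iff_surjective.1 hinj
  -- If `w` is orthogonal to the range of `Ψ - 1`, the transpose of `Ψ` fixes `w`, and symplecticity
  -- makes `J w` a fixed vector of `Ψ`. So `y` is orthogonal to `J w`, that is, `J y` to `w`.
  have hmem : J y ∈ R := by
    rw [← Submodule.orthogonal_orthogonal R, Submodule.mem_orthogonal]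
    intro w hw
    have h1 : ∀ z, inner ℝ (Ψ z) w = inner ℝ z w := by
      intro z
      have := (Submodule.mem_orthogonal _ _).1 hw (Ψ z - z) ⟨z, by simp⟩
      rw [inner_sub_left] at this
      linarith
    have h2 : Ψ (J w) = J w := by
      have h3 : ∀ z, inner ℝ (J (Ψ z)) (J w - Ψ (J w)) = 0 := by
        intro z
        rw [inner_sub_right, hΨ, hJ, hJ2, hJ, hJ2, inner_neg_right, inner_neg_right, h1, sub_self]
      obtain ⟨z, hz⟩ := hsurj (-J (J w - Ψ (J w)))
      have h4 := h3 z
      rw [hz, map_neg, hJ2, neg_neg] at h4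
      exact (sub_eq_zero.1 (inner_self_eq_zero.1 h4)).symm
    have h5 := hy _ h2
    rw [real_inner_comm, hJ, h5, neg_zero]
  obtain ⟨a, ha⟩ := hmem
  refine ⟨a, ?_⟩
  rw [← ha]
  simp

theorem List.sum_flatMap_pair {α M : Type*} [AddCommMonoid M] (f g : α → M) (l : List α) :
    (l.flatMap fun q => [f q, g q]).sum = (l.map f).sum + (l.map g).sum := by
  induction l with
  | nil => simp
  | cons q l ih =>
    simp only [List.flatMap_cons, List.sum_append, List.sum_cons, List.sum_nil, ih, List.map_cons]
    abel

/-- If a polygon from `x` to `Ψ x` maximises the action among those of the same cost, then a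
translate of it by a fixed vector of `Ψ` is contained in a multiple of the convex body `K`. -/
theorem exists_translate_mem_smul [FiniteDimensional ℝ E] {Ψ : E →L[ℝ] E}
    (hJ : ∀ x y, inner ℝ (J x) y = -inner ℝ x (J y)) (hJ2 : ∀ x, J (J x) = -x)
    (hΨ : ∀ x y, inner ℝ (J (Ψ x)) (Ψ y) = inner ℝ (J x) y) {K : Set E} (hKc : IsCompact K)
    (hKconv : Convex ℝ K) (hKne : K.Nonempty) {m : ℝ}
    (hmax : ∀ (x : E) (Q : List (E × ℝ)), (∀ q ∈ Q, ∀ z ∈ K, inner ℝ z q.1 ≤ q.2) →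
      x + J (Q.map Prod.fst).sum = Ψ x →
      pathSum J x (Q.map Prod.fst) ≤ m * (Q.map Prod.snd).sum ^ 2)
    {k : ℕ} {x : E} {v : Fin k → E} {c : Fin k → ℝ} (hv : ∀ j, ∀ z ∈ K, inner ℝ z (v j) ≤ c j)
    (hc : ∑ j, c j = 1) (hx : x + J (∑ j, v j) = Ψ x) (hm : pathSum J x (List.ofFn v) = m) :
    ∃ a, Ψ a = a ∧ ∀ j, ∃ z ∈ K, x + J (∑ i ∈ Finset.univ.filter (· < j), v i) + a = m • z := by
  set p : Fin k → E := fun j => x + J (∑ i ∈ Finset.univ.filter (· < j), v i) with hp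
  let S : Fin k → Set E := fun j => (fun z => m • z + (-p j)) '' K
  let T : Submodule ℝ (Fin k → E) := (LinearMap.ker
    ((Ψ - ContinuousLinearMap.id ℝ E : E →L[ℝ] E) : E →ₗ[ℝ] E)).map
      (LinearMap.pi fun _ => LinearMap.id)
  have hT : ∀ e, Ψ e = e → (fun _ => e) ∈ T := by
    intro e he
    exact ⟨e, by simp [he], by ext; simp⟩
  -- The claim says that the product of the sets `m K - p j` meets the diagonal copy of the fixed
  -- space. Otherwise separate the two: the functional vanishes on the diagonal, so its components
  -- `y j` sum to a vector orthogonal to the fixed space.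
  by_cases hdis : Disjoint (univ.pi S) (T : Set (Fin k → E))
  · exfalso
    have hSc : IsCompact (univ.pi S) := isCompact_univ_pi fun j => hKc.image (by fun_prop)
    have hSconv : Convex ℝ (univ.pi S) := convex_pi fun j _ => by
      have : S j = (fun z => z + (-p j)) '' ((fun z => m • z) '' K) := by
        rw [image_image]
      rw [this]
      have h1 : Convex ℝ ((fun z => m • z) '' K) := hKconv.smul m
      simpa using h1.translate_preimage_left (p j)
    obtain ⟨f, u, u', hfu, huu, hfT⟩ := geometric_hahn_banach_compact_closed hSconv hSc T.convex
      T.closed_of_finiteDimensional hdis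
    have hu' : u' < 0 := by simpa using hfT 0 T.zero_mem
    have hf0 : ∀ b ∈ T, f b = 0 := by
      intro b hb
      by_contra hne
      have := hfT ((u' / f b) • b) (T.smul_mem _ hb)
      rw [map_smul, smul_eq_mul, div_mul_cancel₀ _ hne] at this
      exact lt_irrefl _ this
    let y : Fin k → E := fun j => (InnerProductSpace.toDual ℝ E).symm
      (f.comp (ContinuousLinearMap.single ℝ (fun _ : Fin k => E) j))
    have hf : ∀ b, f b = ∑ j, inner ℝ (y j) (b j) := by
      intro b
      have : ∀ j, inner ℝ (y j) (b j) = f (Pi.single j (b j)) := fun j => by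
        simp only [y, InnerProductSpace.toDual_symm_apply]
        simp
      simp only [this]
      rw [← map_sum, Finset.univ_sum_single]
    obtain ⟨a, ha⟩ := exists_add_eq_of_orthogonal_fixed hJ hJ2 hΨ (y := ∑ j, y j) (by
      intro e he
      rw [sum_inner]
      simpa [hf] using hf0 _ (hT e he))
    choose z hzK hz using fun j => hKc.exists_isMaxOn hKne
      (f := fun z => inner ℝ z (y j)) (by fun_prop)
    set V := ∑ j, inner ℝ (y j) (p j) with hV
    set C := ∑ j, inner ℝ (z j) (y j) with hC
    have hsep : m * C < V := by
      have h1 := hfu (fun j => m • z j + (-p j)) fun j _ => ⟨z j, hzK j, rfl⟩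
      have h2 : f (fun j => m • z j + (-p j)) = m * C - V := by
        rw [hf, hC, hV, Finset.mul_sum, ← Finset.sum_sub_distrib]
        refine Finset.sum_congr rfl fun j _ => ?_
        rw [inner_add_right, inner_neg_right, real_inner_smul_right, real_inner_comm (z j)]
        ring
      linarith
    obtain ⟨R, hR⟩ := exists_pathSum_insert_eq hJ hJ2 x a (List.ofFn fun j => (y j, v j))
    have hfst : ((List.ofFn fun j => (y j, v j)).map Prod.fst).sum = ∑ j, y j := by
      rw [List.map_ofFn, List.sum_ofFn]
      rfl
    have hsnd : (List.ofFn fun j => (y j, v j)).map Prod.snd = List.ofFn v := by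
      rw [List.map_ofFn]
      rfl
    -- Inserting `ε • J (y j)` at the vertex `p j` and starting at `x + ε • a` keeps the endpoint
    -- condition. The boundary terms of the variation cancel because `Ψ` is symplectic.
    have hvar : ∀ ε : ℝ, 0 ≤ ε → m + ε * (2 * V) + ε ^ 2 * R ≤ m * (1 + ε * C) ^ 2 := by
      intro ε hε
      let Q : List (E × ℝ) := (List.ofFn id).flatMap fun j =>
        [(ε • y j, ε * inner ℝ (z j) (y j)), (v j, c j)]
      have hQ1 : Q.map Prod.fst =
          (List.ofFn fun j => (y j, v j)).flatMap fun p => [ε • p.1, p.2] := by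
        have : (List.ofFn fun j => (y j, v j)) = (List.ofFn id).map fun j => (y j, v j) := by
          rw [List.map_ofFn]
          rfl
        rw [this, List.flatMap_map, List.map_flatMap]
        rfl
      have hQ2 : (Q.map Prod.snd).sum = 1 + ε * C := by
        have : Q.map Prod.snd = (List.ofFn id).flatMap fun j =>
            [ε * inner ℝ (z j) (y j), c j] := by
          rw [List.map_flatMap]
          rfl
        rw [this, List.sum_flatMap_pair, List.map_ofFn, List.map_ofFn, List.sum_ofFn,
          List.sum_ofFn, ← hc, hC, Finset.mul_sum, add_comm]
        rfl
      have hsum : (Q.map Prod.fst).sum = ε • ∑ j, y j + ∑ j, v j := by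
        have : Q.map Prod.fst = (List.ofFn id).flatMap fun j => [ε • y j, v j] := by
          rw [List.map_flatMap]
          rfl
        rw [this, List.sum_flatMap_pair, List.map_ofFn, List.map_ofFn, List.sum_ofFn,
          List.sum_ofFn, Finset.smul_sum]
        rfl
      have hb := hmax (x + ε • a) Q (by
        intro q hq z' hz'
        obtain ⟨j, -, hj⟩ := List.mem_flatMap.1 hq
        simp only [List.mem_cons, List.not_mem_nil, or_false] at hj
        rcases hj with rfl | rfl
        · simp only [real_inner_smul_right]
          exact mul_le_mul_of_nonneg_left (hz j hz') hε
        · exact hv j z' hz') (by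
        rw [hsum]
        simp only [map_add, map_smul, ← ha, ← hx]
        module)
      rw [hQ1, hR, hQ2, hsnd, hm, vertexSum_ofFn, hfst, List.sum_ofFn, hx, ha, hΨ] at hb
      have e : 2 * V + inner ℝ (J x) a - inner ℝ (J x) a = 2 * V := by ring
      rw [e] at hb
      exact hb
    have hden : 0 < |m * C ^ 2| + |R| + 1 := by positivity
    have hd : 0 < V - m * C := by linarith
    -- Small enough for the first-order gain `2 ε (V - m C)` to beat the second-order terms,
    -- contradicting maximality.
    set ε := (V - m * C) / (|m * C ^ 2| + |R| + 1) with hε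
    have hε0 : 0 < ε := div_pos hd hden
    have h1 := hvar ε hε0.le
    have h2 : ε * (2 * (V - m * C)) ≤ ε * (ε * (m * C ^ 2 - R)) := by nlinarith
    have h3 := le_of_mul_le_mul_left h2 hε0
    have h4 : ε * (m * C ^ 2 - R) ≤ ε * (|m * C ^ 2| + |R| + 1) := by
      refine mul_le_mul_of_nonneg_left ?_ hε0.le
      linarith [le_abs_self (m * C ^ 2), neg_abs_le R]
    rw [hε, div_mul_cancel₀ _ hden.ne'] at h4
    rw [hε] at h3
    linarith
  · obtain ⟨b, hbS, e, he, rfl⟩ := not_disjoint_iff.1 hdis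
    refine ⟨e, ?_, fun j => ?_⟩
    · have : Ψ e - e = 0 := by simpa using he
      exact sub_eq_zero.1 this
    · obtain ⟨z, hz, hze⟩ := hbS j (mem_univ j)
      refine ⟨z, hz, ?_⟩
      have hze : m • z + (-p j) = e := hze
      rw [← hze]
      simp only [hp]
      abel

end Variation

/-! ### The isoperimetric inequality for absolutely continuous curves. -/

section AbsolutelyContinuous

variable {E : Type*} [NormedAddCommGroup E] [InnerProductSpace ℝ E]

theorem AbsolutelyContinuousOnInterval.const_inner {z : ℝ → E} {a b : ℝ}
    (hz : AbsolutelyContinuousOnInterval z a b) (u : E) :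
    AbsolutelyContinuousOnInterval (fun t => inner ℝ u (z t)) a b := by
  rw [absolutelyContinuousOnInterval_iff] at hz ⊢
  intro ε hε
  obtain ⟨δ, hδ, h⟩ := hz (ε / (‖u‖ + 1)) (by positivity)
  refine ⟨δ, hδ, fun P hP hlt => ?_⟩
  have h1 := h P hP hlt
  rw [lt_div_iff₀ (by positivity)] at h1
  refine lt_of_le_of_lt ?_ h1
  rw [Finset.sum_mul]
  refine Finset.sum_le_sum fun i _ => ?_
  rw [dist_eq_norm, dist_eq_norm, ← inner_sub_right, mul_comm]
  refine (norm_inner_le_norm _ _).trans ?_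
  exact mul_le_mul_of_nonneg_right (by linarith) (norm_nonneg _)

theorem pathSum_map_range {J : E →L[ℝ] E} (y p : ℕ → E) (hp : ∀ j, p (j + 1) = p j + J (y j))
    (k : ℕ) :
    p 0 + J ((List.range k).map y).sum = p k ∧
    pathSum J (p 0) ((List.range k).map y) = ∑ j ∈ Finset.range k, inner ℝ (y j) (p j) := by
  induction k with
  | zero => simp [pathSum]
  | succ k ih =>
    obtain ⟨h1, h2⟩ := ih
    rw [List.range_succ, List.map_append, List.sum_append, pathSum_append, h1, h2,
      Finset.sum_range_succ, map_add, ← add_assoc, h1, hp]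
    simp [pathSum]

variable [FiniteDimensional ℝ E]

/-- The fundamental theorem of calculus for vector-valued absolutely continuous functions. -/
theorem AbsolutelyContinuousOnInterval.intervalIntegrable_deriv_and_integral_eq {z : ℝ → E}
    {a b : ℝ} (hz : AbsolutelyContinuousOnInterval z a b)
    (hd : ∀ᵐ t ∂(volume.restrict (uIoc a b)), DifferentiableAt ℝ z t) :
    IntervalIntegrable (deriv z) volume a b ∧ ∫ t in a..b, deriv z t = z b - z a := by
  set B := stdOrthonormalBasis ℝ E
  have hae : ∀ᵐ t ∂(volume.restrict (uIoc a b)),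
      ∑ i, deriv (fun t => inner ℝ (B i) (z t)) t • B i = deriv z t := by
    filter_upwards [hd] with t ht
    rw [← B.sum_repr' (deriv z t)]
    refine Finset.sum_congr rfl fun i _ => ?_
    congr 1
    have := ((innerSL ℝ (B i)).hasFDerivAt.comp_hasDerivAt t ht.hasDerivAt).deriv
    simpa [Function.comp_def] using this
  have hint : ∀ i, IntervalIntegrable
      (fun t => deriv (fun t => inner ℝ (B i) (z t)) t • B i) volume a b := fun i =>
    have h := (hz.const_inner (B i)).intervalIntegrable_deriv
    ⟨h.1.smul_const _, h.2.smul_const _⟩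
  have hsum : IntervalIntegrable
      (fun t => ∑ i, deriv (fun t => inner ℝ (B i) (z t)) t • B i) volume a b :=
    ⟨integrable_finsetSum _ fun i _ => (hint i).1, integrable_finsetSum _ fun i _ => (hint i).2⟩
  refine ⟨hsum.congr_ae hae, ?_⟩
  rw [← intervalIntegral.integral_congr_ae_restrict hae, intervalIntegral.integral_finsetSum
    fun i _ => hint i]
  simp only [intervalIntegral.integral_smul_const, (hz.const_inner _).integral_deriv_eq_sub,
    ← inner_sub_right]
  exact B.sum_repr' _

theorem IntervalIntegrable.inner_continuousOn {f z : ℝ → E} {a b : ℝ}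
    (hf : IntervalIntegrable f volume a b) (hz : ContinuousOn z (uIcc a b)) :
    IntervalIntegrable (fun t => inner ℝ (f t) (z t)) volume a b := by
  set B := stdOrthonormalBasis ℝ E
  have : (fun t => inner ℝ (f t) (z t)) =
      fun t => ∑ i, inner ℝ (B i) (f t) * inner ℝ (B i) (z t) := by
    funext t
    rw [← B.sum_inner_mul_inner]
    refine Finset.sum_congr rfl fun i _ => ?_
    rw [real_inner_comm]
  rw [this]
  have hi : ∀ i, IntervalIntegrable (fun t => inner ℝ (B i) (f t) * inner ℝ (B i) (z t))
      volume a b := fun i => by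
    refine IntervalIntegrable.mul_continuousOn ?_ (continuousOn_const.inner hz)
    exact ⟨hf.1.const_inner _, hf.2.const_inner _⟩
  exact ⟨integrable_finsetSum _ fun i _ => (hi i).1, integrable_finsetSum _ fun i _ => (hi i).2⟩

/-- An absolutely continuous curve whose velocity lies in the image under `J` of the normal cone
satisfies the same isoperimetric inequality as the polygons. -/
theorem integral_inner_le_of_normal {J Ψ : E →L[ℝ] E} (hJ2 : ∀ x, J (J x) = -x) {K : Set E}
    {m : ℝ}
    (hmax : ∀ (x : E) (Q : List (E × ℝ)), (∀ q ∈ Q, ∀ z ∈ K, inner ℝ z q.1 ≤ q.2) →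
      x + J (Q.map Prod.fst).sum = Ψ x →
      pathSum J x (Q.map Prod.fst) ≤ m * (Q.map Prod.snd).sum ^ 2)
    {T : ℝ} (hT : 0 < T) {z : ℝ → E} (hz : AbsolutelyContinuousOnInterval z 0 T)
    (hend : z T = Ψ (z 0))
    (hvel : ∀ᵐ t ∂(volume.restrict (Icc 0 T)), DifferentiableAt ℝ z t ∧
      ∀ u ∈ K, inner ℝ u (-J (deriv z t)) ≤ inner ℝ (-J (deriv z t)) (z t)) :
    ∫ t in (0 : ℝ)..T, inner ℝ (-J (deriv z t)) (z t) ≤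
      m * (∫ t in (0 : ℝ)..T, inner ℝ (-J (deriv z t)) (z t)) ^ 2 := by
  set g := deriv z with hg
  set f : ℝ → ℝ := fun t => inner ℝ (-J (g t)) (z t) with hf
  have hsub : ∀ {a b : ℝ}, 0 ≤ a → a ≤ b → b ≤ T →
      Icc a b ⊆ Icc 0 T := fun ha _ hb => Icc_subset_Icc ha hb
  have hzc : ContinuousOn z (Icc 0 T) := by
    simpa [uIcc_of_le hT.le] using hz.continuousOn
  have hvel' : ∀ {a b : ℝ}, 0 ≤ a → a ≤ b → b ≤ T → ∀ᵐ t ∂(volume.restrict (Icc a b)),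
      DifferentiableAt ℝ z t ∧ ∀ u ∈ K, inner ℝ u (-J (g t)) ≤ f t := fun ha hab hb =>
    ae_restrict_of_ae_restrict_of_subset (hsub ha hab hb) hvel
  have hftc : ∀ {a b : ℝ}, 0 ≤ a → a ≤ b → b ≤ T →
      IntervalIntegrable g volume a b ∧ ∫ t in a..b, g t = z b - z a := by
    intro a b ha hab hb
    refine AbsolutelyContinuousOnInterval.intervalIntegrable_deriv_and_integral_eq
      (hz.mono ?_) ?_
    · rw [uIcc_of_le hab, uIcc_of_le hT.le]
      exact hsub ha hab hb
    · rw [uIoc_of_le hab]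
      exact (ae_restrict_of_ae_restrict_of_subset Ioc_subset_Icc_self (hvel' ha hab hb)).mono
        fun t ht => ht.1
  have hJg : ∀ {a b : ℝ}, 0 ≤ a → a ≤ b → b ≤ T →
      IntervalIntegrable (fun t => -J (g t)) volume a b := by
    intro a b ha hab hb
    have h1 := (hftc ha hab hb).1
    exact ⟨(J.integrable_comp h1.1).neg, (J.integrable_comp h1.2).neg⟩
  have hfint : ∀ {a b : ℝ}, 0 ≤ a → a ≤ b → b ≤ T → IntervalIntegrable f volume a b := by
    intro a b ha hab hb
    refine (hJg ha hab hb).inner_continuousOn (hzc.mono ?_)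
    rw [uIcc_of_le hab]
    exact hsub ha hab hb
  have hinner : ∀ {a b : ℝ}, 0 ≤ a → a ≤ b → b ≤ T → ∀ u : E,
      IntervalIntegrable (fun t => inner ℝ u (-J (g t))) volume a b ∧
      ∫ t in a..b, inner ℝ u (-J (g t)) = inner ℝ u (-J (z b - z a)) := by
    intro a b ha hab hb u
    have h1 := hJg ha hab hb
    refine ⟨⟨h1.1.const_inner _, h1.2.const_inner _⟩, ?_⟩
    have h2 := ((innerSL ℝ u).comp (-J)).intervalIntegral_comp_comm (hftc ha hab hb).1
    rw [(hftc ha hab hb).2] at h2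
    exact h2
  set W := ∫ t in (0 : ℝ)..T, f t with hW
  set G := ∫ t in (0 : ℝ)..T, ‖J (g t)‖ with hG
  have hnorm : ∀ {a b : ℝ}, 0 ≤ a → a ≤ b → b ≤ T →
      IntervalIntegrable (fun t => ‖J (g t)‖) volume a b := by
    intro a b ha hab hb
    simpa using (hJg ha hab hb).norm
  -- Inscribe a polygon in `z` with `k` equal time steps, short enough that `z` varies by less than
  -- `ε` on each.
  have key : ∀ ε > 0, W ≤ m * W ^ 2 + ε * G := by
    intro ε hε
    have huc := isCompact_Icc.uniformContinuousOn_of_continuous hzc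
    rw [Metric.uniformContinuousOn_iff] at huc
    obtain ⟨δ, hδ, hδz⟩ := huc ε hε
    obtain ⟨k, hk⟩ := exists_nat_gt (T / δ)
    have hk0 : (0 : ℝ) < k := lt_of_le_of_lt (by positivity) hk
    have hkδ : T / k < δ := by
      rw [div_lt_iff₀ hδ] at hk
      rw [div_lt_iff₀ hk0]
      linarith
    let τ : ℕ → ℝ := fun j => j * (T / k)
    have hτ0 : ∀ j, 0 ≤ τ j := fun j => by positivity
    have hτs : ∀ j, τ (j + 1) = τ j + T / k := fun j => by
      simp only [τ]
      push_cast
      ring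
    have hτle : ∀ j, τ j ≤ τ (j + 1) := fun j => by
      rw [hτs]
      have : 0 ≤ T / k := by positivity
      linarith
    have hτk : τ k = T := by
      simp only [τ]
      field_simp
    have hτT : ∀ j, j < k → τ (j + 1) ≤ T := by
      intro j hj
      rw [← hτk]
      simp only [τ]
      gcongr
      exact_mod_cast hj
    have hτz : τ 0 = 0 := by simp [τ]
    have hsum : ∀ φ : ℝ → ℝ, (∀ {a b : ℝ}, 0 ≤ a → a ≤ b → b ≤ T →
        IntervalIntegrable φ volume a b) →
        ∑ j ∈ Finset.range k, ∫ t in τ j..τ (j + 1), φ t = ∫ t in (0 : ℝ)..T, φ t := by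
      intro φ hφ
      rw [intervalIntegral.sum_integral_adjacent_intervals
        fun j hj => hφ (hτ0 j) (hτle j) (hτT j hj), hτz, hτk]
    let y : ℕ → E := fun j => -J (z (τ (j + 1)) - z (τ j))
    have hpath := pathSum_map_range (J := J) y (fun j => z (τ j)) (fun j => by
      simp only [y, map_neg, hJ2]
      abel) k
    simp only [hτz, hτk] at hpath
    -- Each chord is charged the integral of `f` over its time step: integrating the normal-cone
    -- inequality shows that this bounds the support function of the chord. The charges add up to
    -- `W`.
    let Q : List (E × ℝ) := (List.range k).map fun j => (y j, ∫ t in τ j..τ (j + 1), f t)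
    have hQ1 : Q.map Prod.fst = (List.range k).map y := by
      simp [Q, Function.comp_def]
    have hQ2 : (Q.map Prod.snd).sum = W := by
      rw [hW, ← hsum f hfint, List.map_map]
      rfl
    have hb := hmax (z 0) Q (by
      intro q hq u hu
      obtain ⟨j, hj, rfl⟩ := List.mem_map.1 hq
      have hj := List.mem_range.1 hj
      have h1 := hinner (hτ0 j) (hτle j) (hτT j hj) u
      simp only [y]
      rw [← h1.2]
      refine intervalIntegral.integral_mono_ae_restrict (hτle j) h1.1
        (hfint (hτ0 j) (hτle j) (hτT j hj)) ?_
      exact (hvel' (hτ0 j) (hτle j) (hτT j hj)).mono fun t ht => ht.2 u hu) (by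
      rw [hQ1, hpath.1, hend])
    rw [hQ1, hQ2, hpath.2] at hb
    have hloc : ∀ j ∈ Finset.range k, ∫ t in τ j..τ (j + 1), f t ≤
        inner ℝ (y j) (z (τ j)) + ε * ∫ t in τ j..τ (j + 1), ‖J (g t)‖ := by
      intro j hj
      have hj := Finset.mem_range.1 hj
      have h1 := hinner (hτ0 j) (hτle j) (hτT j hj) (z (τ j))
      have h2 := hnorm (hτ0 j) (hτle j) (hτT j hj)
      rw [real_inner_comm, ← h1.2, ← intervalIntegral.integral_const_mul,
        ← intervalIntegral.integral_add h1.1 (h2.const_mul ε)]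
      refine intervalIntegral.integral_mono_on (hτle j) (hfint (hτ0 j) (hτle j) (hτT j hj))
        (h1.1.add (h2.const_mul ε)) fun t ht => ?_
      have hd : dist (z t) (z (τ j)) < ε := by
        refine hδz t (hsub (hτ0 j) (hτle j) (hτT j hj) ht) (τ j)
          (hsub (hτ0 j) (hτle j) (hτT j hj) (left_mem_Icc.2 (hτle j))) ?_
        rw [Real.dist_eq, abs_of_nonneg (by linarith [ht.1])]
        have := ht.2
        rw [hτs] at this
        linarith
      have h3 : f t = inner ℝ (z (τ j)) (-J (g t)) + inner ℝ (-J (g t)) (z t - z (τ j)) := by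
        rw [inner_sub_right, real_inner_comm (-J (g t)) (z (τ j))]
        ring
      rw [h3]
      have h4 := real_inner_le_norm (-J (g t)) (z t - z (τ j))
      rw [norm_neg] at h4
      rw [dist_eq_norm] at hd
      have h5 : ‖J (g t)‖ * ‖z t - z (τ j)‖ ≤ ε * ‖J (g t)‖ := by
        rw [mul_comm]
        exact mul_le_mul_of_nonneg_right hd.le (norm_nonneg _)
      linarith
    have h6 := Finset.sum_le_sum hloc
    rw [Finset.sum_add_distrib, ← Finset.mul_sum, hsum f hfint, hsum _ hnorm] at h6
    linarith
  have hG0 : 0 ≤ G := intervalIntegral.integral_nonneg hT.le fun t _ => norm_nonneg _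
  refine le_of_forall_pos_le_add fun η hη => ?_
  refine (key (η / (G + 1)) (by positivity)).trans ?_
  have : η / (G + 1) * G ≤ η := by
    rw [div_mul_eq_mul_div, div_le_iff₀ (by positivity)]
    nlinarith
  linarith

end AbsolutelyContinuous

/-! ### Piecewise affine curves. -/

section PiecewiseAffine

theorem exists_mem_Icc_of_monotone {m : ℕ} (hm : 0 < m) {τ : Fin (m + 1) → ℝ} {t : ℝ}
    (h0 : τ 0 ≤ t) (h1 : t ≤ τ (Fin.last m)) :
    ∃ j : Fin m, t ∈ Icc (τ j.castSucc) (τ j.succ) := by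
  have key : ∀ j : Fin (m + 1), 0 < j → t ≤ τ j →
      ∃ j : Fin m, t ∈ Icc (τ j.castSucc) (τ j.succ) := by
    intro j
    induction j using Fin.induction with
    | zero => exact fun h => absurd h (lt_irrefl _)
    | succ j ih =>
      intro _ hj
      by_cases hle : τ j.castSucc ≤ t
      · exact ⟨j, hle, hj⟩
      · refine ih ?_ (not_le.1 hle).le
        rw [Fin.pos_iff_ne_zero]
        intro h
        exact hle (h ▸ h0)
  exact key _ (by simpa [Fin.lt_def] using hm) h1

variable {E : Type*} [NormedAddCommGroup E] [NormedSpace ℝ E]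

/-- A curve on `[0, 1]` which is affine with velocity `w j` on the interval
`[τ j, τ (j + 1)]`. -/
structure IsPiecewiseAffine {m : ℕ} (τ : Fin (m + 1) → ℝ) (w : Fin m → E) (γ : ℝ → E) : Prop where
  strictMono : StrictMono τ
  zero : τ 0 = 0
  last : τ (Fin.last m) = 1
  eq : ∀ j : Fin m, ∀ t ∈ Icc (τ j.castSucc) (τ j.succ),
    γ t = γ (τ j.castSucc) + (t - τ j.castSucc) • w j

theorem exists_piecewiseAffine {m : ℕ} {d : Fin m → ℝ} (hd : ∀ j, 0 < d j) (hsum : ∑ j, d j = 1)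
    (w : Fin m → E) (p : E) :
    ∃ (τ : Fin (m + 1) → ℝ) (γ : ℝ → E), IsPiecewiseAffine τ w γ ∧ (∃ C, LipschitzWith C γ) ∧
      γ 0 = p ∧ ∀ j : Fin m, τ j.succ = τ j.castSucc + d j := by
  let τ : Fin (m + 1) → ℝ := fun j => ∑ i : Fin m, if i.castSucc < j then d i else 0
  -- A sum of clamped ramps, one per piece. Each ramp is `1`-Lipschitz in `t`, which makes the curve
  -- globally Lipschitz and hence absolutely continuous.
  let γ : ℝ → E := fun t => p + ∑ i, (max 0 (min (t - τ i.castSucc) (d i))) • w i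
  have hsucc : ∀ j : Fin m, τ j.succ = τ j.castSucc + d j := by
    intro j
    have : ∀ i : Fin m, (if i.castSucc < j.succ then d i else 0) =
        (if i.castSucc < j.castSucc then d i else 0) + if i = j then d i else 0 := by
      intro i
      rcases lt_trichotomy i j with h | h | h
      · simp [Fin.castSucc_lt_succ_iff, h, h.le, h.ne]
      · simp [h]
      · simp [Fin.castSucc_lt_succ_iff, h.not_ge, h.not_gt, h.ne']
    simp only [τ, this, Finset.sum_add_distrib, Finset.sum_ite_eq', Finset.mem_univ, if_true]
  have hmono : StrictMono τ := Fin.strictMono_iff_lt_succ.2 fun j => by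
    rw [hsucc]
    linarith [hd j]
  have hτ0 : τ 0 = 0 := by simp [τ]
  have hτl : τ (Fin.last m) = 1 := by simp [τ, Fin.castSucc_lt_last, hsum]
  have hclamp : ∀ j : Fin m, ∀ t ∈ Icc (τ j.castSucc) (τ j.succ), ∀ i,
      max 0 (min (t - τ i.castSucc) (d i)) = (if i < j then d i else 0) +
        if i = j then t - τ j.castSucc else 0 := by
    intro j t ht i
    rcases lt_trichotomy i j with h | h | h
    · have h1 : τ i.succ ≤ τ j.castSucc := hmono.monotone (Fin.succ_le_castSucc_iff.2 h)
      rw [hsucc] at h1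
      rw [if_pos h, if_neg h.ne, min_eq_right (by linarith [ht.1]), max_eq_right (hd i).le,
        add_zero]
    · subst h
      have h1 := ht.2
      rw [hsucc] at h1
      rw [if_neg (lt_irrefl _), if_pos rfl, min_eq_left (by linarith),
        max_eq_right (by linarith [ht.1]), zero_add]
    · have h1 : τ j.succ ≤ τ i.castSucc := hmono.monotone (Fin.succ_le_castSucc_iff.2 h)
      rw [if_neg h.not_gt, if_neg h.ne', max_eq_left, add_zero]
      exact (min_le_left _ _).trans (by linarith [ht.2])
  refine ⟨τ, γ, ⟨hmono, hτ0, hτl, ?_⟩, ⟨∑ i, ‖w i‖₊, ?_⟩, ?_, hsucc⟩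
  · intro j t ht
    have h0 := hclamp j _ (left_mem_Icc.2 (ht.1.trans ht.2))
    simp only [γ, hclamp j t ht, h0]
    simp only [add_smul, ite_smul, zero_smul, Finset.sum_add_distrib, Finset.sum_ite_eq',
      Finset.mem_univ, if_true, sub_self]
    abel
  · refine LipschitzWith.of_dist_le_mul fun s t => ?_
    simp only [γ, dist_add_left]
    rw [NNReal.coe_sum, Finset.sum_mul]
    refine (dist_sum_sum_le _ _ _).trans (Finset.sum_le_sum fun i _ => ?_)
    rw [dist_eq_norm, ← sub_smul, norm_smul, mul_comm, coe_nnnorm]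
    refine mul_le_mul_of_nonneg_left ?_ (norm_nonneg _)
    rw [Real.norm_eq_abs, Real.dist_eq]
    have h1 := abs_max_sub_max_le_max 0 (min (s - τ i.castSucc) (d i)) 0
      (min (t - τ i.castSucc) (d i))
    have h2 := abs_min_sub_min_le_max (s - τ i.castSucc) (d i) (t - τ i.castSucc) (d i)
    simp only [sub_self, abs_zero, sub_sub_sub_cancel_right, abs_nonneg, sup_of_le_right,
      sup_of_le_left] at h1 h2
    exact h1.trans h2
  · have : ∀ i, max 0 (min (0 - τ i.castSucc) (d i)) = 0 := by
      intro i
      refine max_eq_left ((min_le_left _ _).trans ?_)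
      have := hmono.monotone (Fin.zero_le i.castSucc)
      rw [hτ0] at this
      linarith
    simp only [γ, this, zero_smul, Finset.sum_const_zero, add_zero]

namespace IsPiecewiseAffine

variable {m : ℕ} {τ : Fin (m + 1) → ℝ} {w : Fin m → E} {γ : ℝ → E}

theorem pos (h : IsPiecewiseAffine τ w γ) : 0 < m := by
  rcases Nat.eq_zero_or_pos m with rfl | hm
  · have h1 := h.zero
    have h2 := h.last
    rw [show Fin.last 0 = 0 from rfl, h1] at h2
    exact absurd h2 zero_ne_one
  · exact hm

theorem nonneg (h : IsPiecewiseAffine τ w γ) (j : Fin (m + 1)) : 0 ≤ τ j :=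
  h.zero ▸ h.strictMono.monotone (Fin.zero_le j)

theorem le_one (h : IsPiecewiseAffine τ w γ) (j : Fin (m + 1)) : τ j ≤ 1 :=
  h.last ▸ h.strictMono.monotone (Fin.le_last j)

theorem lt_succ (h : IsPiecewiseAffine τ w γ) (j : Fin m) : τ j.castSucc < τ j.succ :=
  h.strictMono Fin.castSucc_lt_succ

theorem exists_mem (h : IsPiecewiseAffine τ w γ) {t : ℝ} (ht : t ∈ Icc (0 : ℝ) 1) :
    ∃ j : Fin m, t ∈ Icc (τ j.castSucc) (τ j.succ) :=
  exists_mem_Icc_of_monotone h.pos (h.zero.le.trans ht.1) (ht.2.trans h.last.ge)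

theorem ae_exists_mem (h : IsPiecewiseAffine τ w γ) :
    ∀ᵐ t ∂(volume.restrict (Icc (0 : ℝ) 1)), ∃ j : Fin m, t ∈ Ioo (τ j.castSucc) (τ j.succ) := by
  have h1 : ∀ᵐ t ∂(volume.restrict (Icc (0 : ℝ) 1)), t ∉ range τ :=
    ae_restrict_of_ae ((finite_range τ).countable.ae_notMem volume)
  filter_upwards [h1, ae_restrict_mem measurableSet_Icc] with t ht ht'
  obtain ⟨j, hj⟩ := h.exists_mem ht'
  exact ⟨j, lt_of_le_of_ne hj.1 fun e => ht ⟨_, e⟩, lt_of_le_of_ne hj.2 fun e => ht ⟨_, e.symm⟩⟩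

theorem hasDerivWithinAt (h : IsPiecewiseAffine τ w γ) {j : Fin m} {t : ℝ}
    (ht : t ∈ Icc (τ j.castSucc) (τ j.succ)) :
    HasDerivWithinAt γ (w j) (Icc (τ j.castSucc) (τ j.succ)) t := by
  have h1 : HasDerivAt (fun t => γ (τ j.castSucc) + (t - τ j.castSucc) • w j)
      ((1 : ℝ) • w j) t :=
    (((hasDerivAt_id t).sub_const _).smul_const (w j)).const_add _
  rw [one_smul] at h1
  exact h1.hasDerivWithinAt.congr (h.eq j) (h.eq j t ht)

theorem hasDerivAt (h : IsPiecewiseAffine τ w γ) {j : Fin m} {t : ℝ}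
    (ht : t ∈ Ioo (τ j.castSucc) (τ j.succ)) : HasDerivAt γ (w j) t :=
  (h.hasDerivWithinAt (Ioo_subset_Icc_self ht)).hasDerivAt (Icc_mem_nhds ht.1 ht.2)

theorem eq_of_hasDerivWithinAt (h : IsPiecewiseAffine τ w γ) {j : Fin m} {t : ℝ}
    (ht : t ∈ Icc (τ j.castSucc) (τ j.succ)) {v : E}
    (hv : HasDerivWithinAt γ v (Icc 0 1) t) : v = w j :=
  (uniqueDiffOn_Icc (h.lt_succ j) t ht).eq_deriv _
    (hv.mono (Icc_subset_Icc (h.nonneg _) (h.le_one _))) (h.hasDerivWithinAt ht)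

/-- If at most one velocity of a piecewise affine curve belongs to `V`, then the set of times with
velocity in `V` is connected or empty. -/
theorem isPreconnected_velocity (h : IsPiecewiseAffine τ w γ) {V : Set E}
    (hV : ∀ j j', w j ∈ V → w j' ∈ V → j = j') :
    IsPreconnected {t ∈ Icc (0 : ℝ) 1 | ∃ v ∈ V, HasDerivWithinAt γ v (Icc 0 1) t} := by
  have key : ∀ {t}, t ∈ {t ∈ Icc (0 : ℝ) 1 | ∃ v ∈ V, HasDerivWithinAt γ v (Icc 0 1) t} →
      ∃ j, w j ∈ V ∧ t ∈ Icc (τ j.castSucc) (τ j.succ) := by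
    rintro t ⟨ht, v, hv, hd⟩
    obtain ⟨j, hj⟩ := h.exists_mem ht
    exact ⟨j, h.eq_of_hasDerivWithinAt hj hd ▸ hv, hj⟩
  by_cases hex : ∃ j, w j ∈ V
  · obtain ⟨j, hj⟩ := hex
    -- The set lies between an open piece and its closure; whether the breakpoints belong to it is
    -- irrelevant.
    refine (isPreconnected_Ioo (a := τ j.castSucc) (b := τ j.succ)).subset_closure ?_ ?_
    · intro t ht
      exact ⟨⟨(h.nonneg _).trans ht.1.le, ht.2.le.trans (h.le_one _)⟩, w j, hj,
        (h.hasDerivAt ht).hasDerivWithinAt⟩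
    · intro t ht
      obtain ⟨j', hj', htj⟩ := key ht
      rw [hV j j' hj hj', closure_Ioo (h.lt_succ _).ne]
      exact htj
  · convert isPreconnected_empty
    ext t
    simp only [mem_empty_iff_false, iff_false]
    intro ht
    obtain ⟨j, hj, -⟩ := key ht
    exact hex ⟨j, hj⟩

/-- The velocity of a piecewise affine curve with `m` pieces has at most `m` discontinuities. -/
theorem encard_discontinuities_le (h : IsPiecewiseAffine τ w γ) :
    {t ∈ Icc (0 : ℝ) 1 | ¬ (DifferentiableWithinAt ℝ γ (Icc 0 1) t ∧
      ContinuousWithinAt (derivWithin γ (Icc 0 1)) (Icc 0 1) t)}.encard ≤ m := by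
  have hsub : {t ∈ Icc (0 : ℝ) 1 | ¬ (DifferentiableWithinAt ℝ γ (Icc 0 1) t ∧
      ContinuousWithinAt (derivWithin γ (Icc 0 1)) (Icc 0 1) t)} ⊆
      (fun j : Fin m => τ j.castSucc) '' univ := by
    rintro t ⟨ht, hbad⟩
    by_contra hnot
    apply hbad
    obtain ⟨j, hj⟩ := h.exists_mem ht
    have hjt : τ j.castSucc < t :=
      lt_of_le_of_ne hj.1 fun e => hnot ⟨j, mem_univ _, e⟩
    -- The final time counts as regular, since derivatives are taken within `[0, 1]`. Only the `m`
    -- left endpoints can be bad, which gives `m` rather than `m + 1`.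
    have hor : t < τ j.succ ∨ τ j.succ = 1 := by
      rcases hj.2.lt_or_eq with hlt | heq
      · exact Or.inl hlt
      · right
        rcases Fin.eq_castSucc_or_eq_last j.succ with ⟨k, hk⟩ | hk
        · exact absurd ⟨k, mem_univ _, by rw [heq, hk]⟩ hnot
        · rw [hk, h.last]
    have hd : ∀ s ∈ Icc (0 : ℝ) 1, τ j.castSucc < s → (s < τ j.succ ∨ τ j.succ = 1) →
        HasDerivWithinAt γ (w j) (Icc 0 1) s := by
      intro s hs hjs hor
      rcases hor with hlt | heq
      · exact (h.hasDerivAt ⟨hjs, hlt⟩).hasDerivWithinAt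
      · refine (h.hasDerivWithinAt ⟨hjs.le, heq ▸ hs.2⟩).mono_of_mem_nhdsWithin ?_
        filter_upwards [self_mem_nhdsWithin, mem_nhdsWithin_of_mem_nhds (Ioi_mem_nhds hjs)]
          with r hr hr'
        exact ⟨le_of_lt hr', heq ▸ hr.2⟩
    have hev : ∀ᶠ s in nhdsWithin t (Icc 0 1), derivWithin γ (Icc 0 1) s = w j := by
      have h2 : ∀ᶠ s in nhdsWithin t (Icc 0 1), s < τ j.succ ∨ τ j.succ = 1 := by
        rcases hor with hlt | heq
        · filter_upwards [mem_nhdsWithin_of_mem_nhds (Iio_mem_nhds hlt)] with s hs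
          exact Or.inl hs
        · exact Filter.Eventually.of_forall fun _ => Or.inr heq
      filter_upwards [self_mem_nhdsWithin, mem_nhdsWithin_of_mem_nhds (Ioi_mem_nhds hjt), h2]
        with s hs hs1 hs2
      exact (hd s hs hs1 hs2).derivWithin (uniqueDiffOn_Icc one_pos s hs)
    refine ⟨(hd t ht hjt hor).differentiableWithinAt, ?_⟩
    refine (continuousWithinAt_const (b := w j)).congr_of_eventuallyEq hev ?_
    exact (hd t ht hjt hor).derivWithin (uniqueDiffOn_Icc one_pos t ht)
  refine (encard_le_encard hsub).trans ((encard_image_le _ _).trans ?_)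
  simp

/-- A convex set that meets only one piece of a piecewise affine curve is visited at most once. -/
theorem isPreconnected_mem_convex (h : IsPiecewiseAffine τ w γ) {C : Set E} (hC : Convex ℝ C)
    (hone : ∀ j j' : Fin m, ∀ t t' : ℝ, t ∈ Icc (τ j.castSucc) (τ j.succ) →
      t' ∈ Icc (τ j'.castSucc) (τ j'.succ) → γ t ∈ C → γ t' ∈ C → j = j') :
    IsPreconnected {t ∈ Icc (0 : ℝ) 1 | γ t ∈ C} := by
  refine Convex.isPreconnected ?_
  rintro s ⟨hs, hsC⟩ t ⟨ht, htC⟩ a b ha hb hab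
  refine ⟨convex_Icc 0 1 hs ht ha hb hab, ?_⟩
  obtain ⟨j, hj⟩ := h.exists_mem hs
  obtain ⟨j', hj'⟩ := h.exists_mem ht
  obtain rfl := hone j j' s t hj hj' hsC htC
  have hr := convex_Icc _ _ hj hj' ha hb hab
  have : γ (a • s + b • t) = a • γ s + b • γ t := by
    rw [h.eq j _ hr, h.eq j _ hj, h.eq j _ hj', ← sub_eq_zero]
    have hb' : b = 1 - a := by linarith
    subst hb'
    simp only [smul_eq_mul]
    module
  rw [this]
  exact hC hsC htC ha hb hab

end IsPiecewiseAffine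

end PiecewiseAffine

/-! ### The extremal polygon on the boundary. -/

section MinimalPolygon

variable {E : Type*} [NormedAddCommGroup E] [InnerProductSpace ℝ E] {J Ψ : E →L[ℝ] E}

/-- The small square with edges `J u`, `-u`, `-J u`, `u` has positive action. -/
theorem exists_pathSum_pos (hJ2 : ∀ x, J (J x) = -x)
    {u : E} (hu : u ≠ 0) : ∃ L : List E, L.sum = 0 ∧ 0 < pathSum J 0 L := by
  refine ⟨[u, J u, -u, -J u], ?_, ?_⟩
  · simp
  · have h1 : 0 < inner ℝ u u := real_inner_self_pos.2 hu
    have h2 : 0 ≤ inner ℝ (J u) (J u) := real_inner_self_nonneg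
    simp only [pathSum, map_neg, hJ2, inner_zero_right, inner_add_right, inner_neg_left,
      inner_neg_right]
    linarith [real_inner_comm u (J u)]

variable [FiniteDimensional ℝ E] {ι : Type*} [Fintype ι] {ν : ι → E} {h : ι → ℝ}

/-- The action-minimising polygon on the boundary of a polytope, together with the isoperimetric
inequality that it realises. Its vertices are `p j`. -/
theorem exists_minimal_polygon [Nontrivial E] (hJ : ∀ x y, inner ℝ (J x) y = -inner ℝ x (J y))
    (hJ2 : ∀ x, J (J x) = -x) (hΨ : ∀ x y, inner ℝ (J (Ψ x)) (Ψ y) = inner ℝ (J x) y)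
    {K : Set E} (hh : ∀ i, 0 < h i) (hK : K = {x | ∀ i, inner ℝ x (ν i) ≤ h i})
    (h0 : (0 : E) ∈ interior K) (hKb : Bornology.IsBounded K) :
    ∃ (m : ℝ) (k : ℕ) (σ : Fin k → ι) (d : Fin k → ℝ) (p : Fin (k + 1) → E), 0 < m ∧
      Function.Injective σ ∧ (∀ j, 0 < d j) ∧ ∑ j, d j = 1 ∧
      (∀ j : Fin k, p j.succ = p j.castSucc + d j • (m * h (σ j))⁻¹ • J (ν (σ j))) ∧
      p (Fin.last k) = Ψ (p 0) ∧ (∀ j, p j ∈ K) ∧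
      (∀ j : Fin k, inner ℝ (p j.castSucc) (ν (σ j)) = h (σ j)) ∧
      ∀ (x : E) (Q : List (E × ℝ)), (∀ q ∈ Q, ∀ z ∈ K, inner ℝ z q.1 ≤ q.2) →
        x + J (Q.map Prod.fst).sum = Ψ x →
        pathSum J x (Q.map Prod.fst) ≤ m * (Q.map Prod.snd).sum ^ 2 := by
  have hKclosed : IsClosed K := by
    rw [hK, Set.ofPred_forall]
    exact isClosed_iInter fun i => isClosed_le (by fun_prop) continuous_const
  have hKc : IsCompact K := Metric.isCompact_of_isClosed_isBounded hKclosed hKb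
  have hKconv : Convex ℝ K := by
    rw [hK, Set.ofPred_forall]
    refine convex_iInter fun i => ?_
    exact convex_halfSpace_le ⟨fun x y => inner_add_left x y _,
      fun c x => real_inner_smul_left x _ c⟩ _
  have hKne : K.Nonempty := ⟨0, interior_subset h0⟩
  obtain ⟨u, hu⟩ := exists_ne (0 : E)
  obtain ⟨M, hM0, hMpos⟩ := exists_pathSum_pos hJ2 hu
  -- Resolving the edges of the square into facet directions gives a closed admissible polygon of
  -- positive action, starting at the fixed point `0` of `Ψ`.
  obtain ⟨L₀, hL₀, hs₀, -, hle₀⟩ := exists_weightedSteps_of_support hJ hh hK h0 0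
    (M.map fun y => (y, sSup ((fun z => inner ℝ z y) '' K))) (by
      intro q hq z hz
      obtain ⟨y, -, rfl⟩ := List.mem_map.1 hq
      exact le_csSup (hKc.image (by fun_prop)).bddAbove ⟨z, hz, rfl⟩)
  have hM' : (M.map fun y => (y, sSup ((fun z => inner ℝ z y) '' K))).map Prod.fst = M := by
    simp [Function.comp_def]
  rw [hM'] at hs₀ hle₀
  obtain ⟨x, L, hn, hpos, hx, hcost, hm, hmax⟩ := exists_pathSum_max ν h hJ hJ2 hΨ hh hL₀
    (x₀ := 0) (by rw [hs₀, hM0]; simp) (hMpos.trans_le hle₀)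
  set m := pathSum J x (weightedSteps ν L) with hmdef
  have hsupp : ∀ (x : E) (Q : List (E × ℝ)), (∀ q ∈ Q, ∀ z ∈ K, inner ℝ z q.1 ≤ q.2) →
        x + J (Q.map Prod.fst).sum = Ψ x →
        pathSum J x (Q.map Prod.fst) ≤ m * (Q.map Prod.snd).sum ^ 2 := fun x Q hQ hx =>
    pathSum_le_of_support hJ hh hK h0 hm.le hmax hQ hx
  let k := L.length
  let σ : Fin k → ι := fun j => (L.get j).1
  let b : Fin k → ℝ := fun j => (L.get j).2
  let v : Fin k → E := fun j => b j • ν (σ j)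
  have hb : ∀ j, 0 < b j := fun j => hpos _ (L.get_mem j)
  have hLv : weightedSteps ν L = List.ofFn v := by
    conv_lhs => rw [← List.ofFn_get L]
    rw [weightedSteps, List.map_ofFn]
    rfl
  have hcost' : ∑ j, b j * h (σ j) = 1 := by
    rw [← hcost, totalCost]
    conv_rhs => rw [← List.ofFn_get L]
    rw [List.map_ofFn, List.sum_ofFn]
    rfl
  have hσ : Function.Injective σ := by
    have : L.map Prod.fst = List.ofFn σ := by
      conv_lhs => rw [← List.ofFn_get L]
      rw [List.map_ofFn]
      rfl
    rw [this] at hn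
    exact List.nodup_ofFn.1 hn
  have hx' : x + J (∑ j, v j) = Ψ x := by
    rw [← hx, hLv, List.sum_ofFn]
  -- A final zero edge of zero cost makes the endpoint one of the vertices placed in `m K`.
  let v' : Fin (k + 1) → E := Fin.snoc v 0
  obtain ⟨a, ha, hz⟩ := exists_translate_mem_smul hJ hJ2 hΨ hKc hKconv hKne hsupp (x := x)
    (v := v') (c := Fin.snoc (fun j => b j * h (σ j)) 0) (by
      intro j z hz
      rw [hK] at hz
      refine Fin.lastCases ?_ (fun j => ?_) j
      · simp [v']
      · simp only [v', Fin.snoc_castSucc, v, real_inner_smul_right]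
        exact mul_le_mul_of_nonneg_left (hz _) (hb j).le) (by
      simpa [Fin.sum_univ_castSucc] using hcost') (by
      simpa [v', Fin.sum_univ_castSucc] using hx') (by
      rw [hmdef, hLv, pathSum_ofFn, pathSum_ofFn, Fin.sum_univ_castSucc]
      simp [v', Finset.sum_filter, Fin.sum_univ_castSucc])
  choose p hpK hp using hz
  have hp' : ∀ j : Fin (k + 1),
      x + J (∑ i : Fin k, if i.castSucc < j then v i else 0) + a = m • p j := by
    intro j
    rw [← hp j, Finset.sum_filter, Fin.sum_univ_castSucc]
    simp [v']
  have hpm : ∀ j, p j = m⁻¹ • (x + J (∑ i : Fin k, if i.castSucc < j then v i else 0) + a) := by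
    intro j
    rw [hp', smul_smul, inv_mul_cancel₀ hm.ne', one_smul]
  have hYa : inner ℝ (∑ j, v j) a = 0 := by
    have h1 := hΨ x a
    rw [ha, ← hx', map_add, hJ2, inner_add_left, inner_neg_left] at h1
    linarith
  have hface_le : ∀ j ∈ Finset.univ, b j * inner ℝ (p (Fin.castSucc j)) (ν (σ j)) ≤
      b j * h (σ j) := by
    intro j _
    have := hpK j.castSucc
    rw [hK] at this
    exact mul_le_mul_of_nonneg_left (this _) (hb j).le
  -- The translation by `a` does not affect the action, since `a` is orthogonal to the edge sum.
  -- Hence the action `m` and cost `1` force equality in the sum of the facet inequalities, and so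
  -- in each of them.
  have hface_sum : ∑ j, b j * inner ℝ (p (Fin.castSucc j)) (ν (σ j)) = ∑ j, b j * h (σ j) := by
    have h1 : m = ∑ j, inner ℝ (v j)
        (x + J (∑ i ∈ Finset.univ.filter (· < j), v i)) := by
      rw [hmdef, hLv, pathSum_ofFn]
    have h2 : ∀ j : Fin k, inner ℝ (v j) (x + J (∑ i ∈ Finset.univ.filter (· < j), v i)) =
        m * (b j * inner ℝ (p j.castSucc) (ν (σ j))) - inner ℝ (v j) a := by
      intro j
      have h3 : x + J (∑ i ∈ Finset.univ.filter (· < j), v i) = m • p j.castSucc - a := by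
        rw [← hp', Finset.sum_filter]
        simp
      rw [h3, inner_sub_right, real_inner_smul_right]
      simp only [v, real_inner_smul_left]
      rw [real_inner_comm]
    simp only [h2, Finset.sum_sub_distrib, ← Finset.mul_sum, ← sum_inner, hYa, sub_zero] at h1
    rw [hcost']
    have h4 : m * 1 = m * ∑ j, b j * inner ℝ (p (Fin.castSucc j)) (ν (σ j)) := by
      rw [mul_one]
      exact h1
    exact (mul_left_cancel₀ hm.ne' h4).symm
  refine ⟨m, k, σ, fun j => b j * h (σ j), p, hm, hσ, fun j => mul_pos (hb j) (hh _), hcost', ?_,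
    ?_, hpK, ?_, hsupp⟩
  · intro j
    have h1 : ∀ i : Fin k, (if i.castSucc < j.succ then v i else 0) =
        (if i.castSucc < j.castSucc then v i else 0) + if i = j then v i else 0 := by
      intro i
      rcases lt_trichotomy i j with h | h | h
      · simp [Fin.castSucc_lt_succ_iff, h, h.le, h.ne]
      · simp [h]
      · simp [Fin.castSucc_lt_succ_iff, h.not_ge, h.not_gt, h.ne']
    have h2 : (b j * h (σ j)) • (m * h (σ j))⁻¹ • J (ν (σ j)) = m⁻¹ • J (v j) := by
      simp only [v, map_smul, smul_smul]
      congr 1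
      have := (hh (σ j)).ne'
      field_simp
    rw [h2, hpm, hpm]
    simp only [h1, Finset.sum_add_distrib, Finset.sum_ite_eq', Finset.mem_univ, if_true, map_add]
    module
  · rw [hpm, hpm]
    simp only [Fin.castSucc_lt_last, if_true, hx', map_smul, map_add, ha, Fin.not_lt_zero,
      if_false, Finset.sum_const_zero, map_zero, add_zero]
  · intro j
    have := (Finset.sum_eq_sum_iff_of_le hface_le).1 hface_sum j (Finset.mem_univ j)
    exact mul_left_cancel₀ (hb j).ne' this

end MinimalPolygon

/-! ### The standard symplectic structure in matrix form. -/

namespace SymplecticPolytope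

variable {n : ℕ}

theorem inner_act_left (M : Matrix (Fin n ⊕ Fin n) (Fin n ⊕ Fin n) ℝ) (x y : Phase n) :
    inner ℝ (act M x) y = inner ℝ x (act M.transpose y) := by
  have h1 : act M.transpose = ContinuousLinearMap.adjoint (act M) := by
    rw [← ContinuousLinearMap.star_eq_adjoint]
    simp only [act, ← map_star]
    rfl
  rw [h1, ContinuousLinearMap.adjoint_inner_right]

theorem act_mul (M M' : Matrix (Fin n ⊕ Fin n) (Fin n ⊕ Fin n) ℝ) (x : Phase n) :
    act (M * M') x = act M (act M' x) := by
  simp only [act, map_mul]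
  rfl

theorem inner_stdJ_left (x y : Phase n) : inner ℝ (stdJ n x) y = -inner ℝ x (stdJ n y) := by
  rw [stdJ, inner_act_left, Matrix.J_transpose, ← inner_neg_right]
  congr 1
  simp only [act, map_neg]
  rfl

theorem stdJ_stdJ (x : Phase n) : stdJ n (stdJ n x) = -x := by
  rw [stdJ, ← act_mul, Matrix.J_squared]
  simp only [act, map_neg, map_one]
  rfl

theorem inner_stdJ_act {Ψ : Matrix (Fin n ⊕ Fin n) (Fin n ⊕ Fin n) ℝ}
    (hΨ : Ψ ∈ Matrix.symplecticGroup (Fin n) ℝ) (x y : Phase n) :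
    inner ℝ (stdJ n (act Ψ x)) (act Ψ y) = inner ℝ (stdJ n x) y := by
  rw [real_inner_comm, inner_act_left, stdJ, ← act_mul, ← act_mul,
    SymplecticGroup.mem_iff'.1 hΨ, real_inner_comm]

end SymplecticPolytope

/-! ### Lower bound for positive actions. -/

namespace SymplecticPolytope

variable {n : ℕ}

/-- The isoperimetric inequality bounds the positive actions from below. -/
theorem IsGenCharacteristic.inv_le_action {K : Set (Phase n)}
    {Ψ : Matrix (Fin n ⊕ Fin n) (Fin n ⊕ Fin n) ℝ} {m : ℝ} (hm : 0 < m)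
    (hmax : ∀ (x : Phase n) (Q : List (Phase n × ℝ)),
      (∀ q ∈ Q, ∀ z ∈ K, inner ℝ z q.1 ≤ q.2) →
      x + stdJ n (Q.map Prod.fst).sum = act Ψ x →
      pathSum (stdJ n) x (Q.map Prod.fst) ≤ m * (Q.map Prod.snd).sum ^ 2)
    {T : ℝ} {z : ℝ → Phase n} (hz : IsGenCharacteristic K Ψ T z) (hpos : 0 < action T z) :
    (1 / 2) * m⁻¹ ≤ action T z := by
  have h1 := integral_inner_le_of_normal (J := stdJ n) (Ψ := act Ψ) stdJ_stdJ hmax hz.pos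
    hz.absCont hz.endpoint (by
      filter_upwards [hz.velocity] with t ht
      obtain ⟨y, hy, hd⟩ := ht
      refine ⟨hd.differentiableAt, fun u hu => ?_⟩
      rw [hd.deriv, stdJ_stdJ, neg_neg]
      have := hy u hu
      rw [inner_sub_left] at this
      rw [real_inner_comm (z t) y]
      linarith)
  set W := ∫ t in (0 : ℝ)..T, inner ℝ (-(stdJ n (deriv z t))) (z t) with hW
  have hA : action T z = 1 / 2 * W := rfl
  rw [hA] at hpos ⊢
  have hWpos : 0 < W := by linarith
  refine mul_le_mul_of_nonneg_left ?_ (by norm_num)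
  rw [inv_le_iff_one_le_mul₀ hm]
  -- `h1` reads `W ≤ m W²`; divide by `W > 0`.
  nlinarith

end SymplecticPolytope
-- The minimising characteristic.
theorem theorem4p1 (n : ℕ) (hn : 0 < n)
    (K : Set (SymplecticPolytope.Phase n)) (hK : SymplecticPolytope.IsPolytope K)
    (h0 : (0 : SymplecticPolytope.Phase n) ∈ interior K)
    (N : ℕ) (F : Fin N → Set (SymplecticPolytope.Phase n))
    (ν : Fin N → SymplecticPolytope.Phase n) (hF : SymplecticPolytope.IsFacetList K F ν)
    (Ψ : Matrix (Fin n ⊕ Fin n) (Fin n ⊕ Fin n) ℝ)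
    (hΨ : Ψ ∈ Matrix.symplecticGroup (Fin n) ℝ) :
    ∃ γ : ℝ → SymplecticPolytope.Phase n,
      SymplecticPolytope.IsGenCharacteristic K Ψ 1 γ ∧
      -- the action of `γ` is the minimum of the positive actions
      IsLeast {a : ℝ | 0 < a ∧ ∃ (T : ℝ) (x : ℝ → SymplecticPolytope.Phase n),
          SymplecticPolytope.IsGenCharacteristic K Ψ T x ∧ SymplecticPolytope.action T x = a}
        (SymplecticPolytope.action 1 γ) ∧
      -- the velocity is piecewise constant
      (∃ (m : ℕ) (τ : Fin (m + 1) → ℝ) (w : Fin m → SymplecticPolytope.Phase n),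
        StrictMono τ ∧ τ 0 = 0 ∧ τ (Fin.last m) = 1 ∧
        (∀ j : Fin m, ∀ t ∈ Set.Ioo (τ j.castSucc) (τ j.succ), HasDerivAt γ (w j) t) ∧
        (∀ j : Fin m, ∃ i : Fin N, ∃ C : ℝ, 0 < C ∧ w j = C • SymplecticPolytope.stdJ n (ν i)) ∧
        -- each facet direction is used by at most one piece
        (∀ i : Fin N, ∀ j j' : Fin m,
          (∃ C : ℝ, 0 < C ∧ w j = C • SymplecticPolytope.stdJ n (ν i)) →
          (∃ C : ℝ, 0 < C ∧ w j' = C • SymplecticPolytope.stdJ n (ν i)) → j = j')) ∧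
      -- the set of times with a given velocity, or a given velocity direction, is empty or
      -- connected
      (∀ i : Fin N, ∀ C : ℝ, 0 < C →
        IsPreconnected {t ∈ Set.Icc (0 : ℝ) 1 |
          HasDerivWithinAt γ (C • SymplecticPolytope.stdJ n (ν i)) (Set.Icc 0 1) t}) ∧
      (∀ i : Fin N,
        IsPreconnected {t ∈ Set.Icc (0 : ℝ) 1 | ∃ C : ℝ, 0 < C ∧
          HasDerivWithinAt γ (C • SymplecticPolytope.stdJ n (ν i)) (Set.Icc 0 1) t}) ∧
      -- the velocity has at most `N` points of discontinuity
      {t ∈ Set.Icc (0 : ℝ) 1 | ¬ (DifferentiableWithinAt ℝ γ (Set.Icc 0 1) t ∧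
          ContinuousWithinAt (derivWithin γ (Set.Icc 0 1)) (Set.Icc 0 1) t)}.encard ≤ N ∧
      -- the (relative) interior of each facet is visited at most once
      (∀ i : Fin N,
        IsPreconnected {t ∈ Set.Icc (0 : ℝ) 1 | γ t ∈ intrinsicInterior ℝ (F i)}) := by
  have hfac : ∀ i, SymplecticPolytope.IsFacet K (F i) := fun i => by
    have : F i ∈ Set.range F := ⟨i, rfl⟩
    rwa [hF.range_eq] at this
  obtain ⟨h, hh, hKeq, hFeq⟩ := hF.exists_support hK h0
  have hnt : Nontrivial (SymplecticPolytope.Phase n) := by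
    refine Module.nontrivial_of_finrank_pos (R := ℝ) ?_
    rw [SymplecticPolytope.finrank_phase]
    omega
  have hJJ := SymplecticPolytope.stdJ_stdJ (n := n)
  obtain ⟨m, k, σ, d, p, hm, hσ, hd, hd1, hp, hpl, hpK, hpf, hmax⟩ :=
    exists_minimal_polygon SymplecticPolytope.inner_stdJ_left hJJ
      (SymplecticPolytope.inner_stdJ_act hΨ) hh hKeq h0 hK.1
  set J := SymplecticPolytope.stdJ n with hJdef
  -- With this speed `⟨-J w j, γ⟩ = 1 / m` on the facet used by piece `j`, so the action density is
  -- constant.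
  set w : Fin k → SymplecticPolytope.Phase n := fun j => (m * h (σ j))⁻¹ • J (ν (σ j)) with hw
  obtain ⟨τ, γ, hγ, ⟨C, hLip⟩, hγ0, hτd⟩ := exists_piecewiseAffine hd hd1 w (p 0)
  have hmh : ∀ j, 0 < (m * h (σ j))⁻¹ := fun j => inv_pos.2 (mul_pos hm (hh _))
  have hnode : ∀ j : Fin (k + 1), γ (τ j) = p j := by
    intro j
    induction j using Fin.induction with
    | zero => rw [hγ.zero, hγ0]
    | succ j ih =>
      rw [hγ.eq j _ (Set.right_mem_Icc.2 (hγ.lt_succ j).le), ih, hp, hτd, add_sub_cancel_left]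
  have hface : ∀ j : Fin k, ∀ t ∈ Set.Icc (τ j.castSucc) (τ j.succ),
      γ t ∈ K ∧ inner ℝ (γ t) (ν (σ j)) = h (σ j) := by
    intro j t ht
    have hseg : γ t = p j.castSucc + (t - τ j.castSucc) • w j := by rw [hγ.eq j t ht, hnode]
    have hval : ∀ i, inner ℝ (γ t) (ν i) = inner ℝ (p j.castSucc) (ν i) +
        (t - τ j.castSucc) * inner ℝ (w j) (ν i) := by
      intro i
      rw [hseg, inner_add_left, real_inner_smul_left]
    refine ⟨?_, ?_⟩
    · rw [hKeq]
      intro i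
      have h1 : inner ℝ (p j.castSucc) (ν i) ≤ h i := by
        have := hpK j.castSucc
        rw [hKeq] at this
        exact this i
      have h2 : inner ℝ (p j.castSucc) (ν i) + d j * inner ℝ (w j) (ν i) ≤ h i := by
        have := hpK j.succ
        rw [hKeq, hp] at this
        have := this i
        rwa [inner_add_left, real_inner_smul_left] at this
      rw [hval]
      have h3 : 0 ≤ t - τ j.castSucc := by linarith [ht.1]
      have h4 : t - τ j.castSucc ≤ d j := by
        have := ht.2
        rw [hτd] at this
        linarith
      rcases le_total 0 (inner ℝ (w j) (ν i)) with h5 | h5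
      · nlinarith
      · nlinarith
    · have hzero : inner ℝ (w j) (ν (σ j)) = 0 := by
        rw [hw, real_inner_smul_left, real_inner_comm,
          inner_self_apply_eq_zero SymplecticPolytope.inner_stdJ_left, mul_zero]
      rw [hval, hpf, hzero, mul_zero, add_zero]
  have hcone : ∀ j : Fin k, ∀ t ∈ Set.Icc (τ j.castSucc) (τ j.succ), ∀ c : ℝ, 0 ≤ c →
      c • ν (σ j) ∈ SymplecticPolytope.normalCone K (γ t) := by
    intro j t ht c hc u hu
    rw [hKeq] at hu
    rw [real_inner_smul_right, inner_sub_left, (hface j t ht).2]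
    exact mul_nonpos_of_nonneg_of_nonpos hc (sub_nonpos.2 (hu _))
  have hνne : ∀ i, ν i ≠ 0 := fun i => (hF.normal i).ne_zero
  -- Distinct facets have distinct unit normals: equal normals force equal support values, hence the
  -- same face.
  have hνinj : ∀ (c c' : ℝ), 0 < c → 0 < c' → ∀ i i', c • ν i = c' • ν i' → i = i' := by
    intro c c' hc hc' i i' he
    have hcc : c = c' := by
      have := congrArg norm he
      rwa [norm_smul, norm_smul, (hF.normal i).1, (hF.normal i').1, mul_one, mul_one,
        Real.norm_of_nonneg hc.le, Real.norm_of_nonneg hc'.le] at this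
    subst hcc
    have hνe : ν i = ν i' := smul_right_injective _ hc.ne' he
    apply hF.injective
    obtain ⟨x, hx⟩ := (hfac i).nonempty
    obtain ⟨x', hx'⟩ := (hfac i').nonempty
    have hhe : h i = h i' := by
      rw [hFeq] at hx hx'
      have h1 := hx.1
      have h2 := hx'.1
      rw [hKeq] at h1 h2
      have h3 := h1 i'
      have h4 := h2 i
      rw [← hνe, hx.2] at h3
      rw [hνe, hx'.2] at h4
      exact le_antisymm h3 h4
    rw [hFeq, hFeq, hνe, hhe]
  have hJinj : Function.Injective J := by
    intro x y hxy
    have := congrArg J hxy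
    rw [hJJ, hJJ] at this
    exact neg_injective this
  have hwdir : ∀ i, ∀ j : Fin k, ∀ c : ℝ, 0 < c → w j = c • J (ν i) → σ j = i := by
    intro i j c hc he
    refine hνinj _ c (hmh j) hc _ _ (hJinj ?_)
    rw [map_smul, map_smul]
    exact he
  have honedir : ∀ i : Fin N, ∀ j j' : Fin k, (∃ c : ℝ, 0 < c ∧ w j = c • J (ν i)) →
      (∃ c : ℝ, 0 < c ∧ w j' = c • J (ν i)) → j = j' := by
    rintro i j j' ⟨c, hc, he⟩ ⟨c', hc', he'⟩
    exact hσ ((hwdir i j c hc he).trans (hwdir i j' c' hc' he').symm)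
  have hchar : SymplecticPolytope.IsGenCharacteristic K Ψ 1 γ := by
    refine ⟨one_pos, (hLip.lipschitzOnWith).absolutelyContinuousOnInterval, ?_, ?_, ?_, ?_⟩
    · by_contra! hcon
      set j : Fin k := ⟨0, hγ.pos⟩
      have h1 := hcon _ ⟨hγ.nonneg j.succ, hγ.le_one j.succ⟩
      have h2 := hcon _ ⟨hγ.nonneg j.castSucc, hγ.le_one j.castSucc⟩
      rw [hnode, hp, ← hnode, h2] at h1
      have h3 : d j • w j = 0 := add_eq_left.1 h1
      rw [hw, smul_smul, smul_eq_zero, or_iff_right (mul_pos (hd j) (hmh j)).ne'] at h3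
      exact hνne _ (hJinj (by rw [h3, map_zero]))
    · intro t ht
      obtain ⟨j, hj⟩ := hγ.exists_mem ht
      refine ⟨subset_closure (hface j t hj).1, fun hint => ?_⟩
      obtain ⟨r, hr, hb⟩ := Metric.mem_nhds_iff.1 (mem_interior_iff_mem_nhds.1 hint)
      have h1 : γ t + (r / 2) • ν (σ j) ∈ K := hb (by
        rw [Metric.mem_ball, dist_eq_norm, add_sub_cancel_left, norm_smul, (hF.normal _).1,
          Real.norm_of_nonneg (by positivity)]
        linarith)
      rw [hKeq] at h1
      have h2 := h1 (σ j)
      rw [inner_add_left, (hface j t hj).2, real_inner_smul_left, real_inner_self_eq_norm_sq,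
        (hF.normal _).1] at h2
      linarith
    · have h1 := hnode (Fin.last k)
      rw [hγ.last] at h1
      rw [h1, hpl, hγ0]
    · filter_upwards [hγ.ae_exists_mem] with t ht
      obtain ⟨j, hj⟩ := ht
      refine ⟨_, hcone j t (Set.Ioo_subset_Icc_self hj) _ (hmh j).le, ?_⟩
      rw [map_smul]
      exact hγ.hasDerivAt hj
  have haction : SymplecticPolytope.action 1 γ = 1 / 2 * m⁻¹ := by
    have h1 : ∀ᵐ t ∂(MeasureTheory.volume.restrict (Set.uIoc (0 : ℝ) 1)),
        inner ℝ (-(J (deriv γ t))) (γ t) = m⁻¹ := by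
      rw [Set.uIoc_of_le zero_le_one]
      filter_upwards [MeasureTheory.ae_restrict_of_ae_restrict_of_subset
        Set.Ioc_subset_Icc_self hγ.ae_exists_mem] with t ht
      obtain ⟨j, hj⟩ := ht
      rw [(hγ.hasDerivAt hj).deriv, hw, map_smul, hJJ, smul_neg, neg_neg, real_inner_smul_left,
        real_inner_comm, (hface j t (Set.Ioo_subset_Icc_self hj)).2]
      have := (hh (σ j)).ne'
      field_simp
    rw [SymplecticPolytope.action, intervalIntegral.integral_congr_ae_restrict h1]
    simp
  refine ⟨γ, hchar, ⟨⟨?_, 1, γ, hchar, rfl⟩, ?_⟩, ⟨k, τ, w, hγ.strictMono, hγ.zero, hγ.last,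
    fun j t ht => hγ.hasDerivAt ht, fun j => ⟨σ j, _, hmh j, rfl⟩, honedir⟩, ?_, ?_, ?_, ?_⟩
  · rw [haction]
    positivity
  · rintro a ⟨ha, T, x, hx, rfl⟩
    rw [haction]
    exact hx.inv_le_action hm hmax ha
  · intro i c hc
    have := hγ.isPreconnected_velocity (V := {c • J (ν i)}) fun j j' hj hj' =>
      honedir i j j' ⟨c, hc, hj⟩ ⟨c, hc, hj'⟩
    simpa using this
  · intro i
    have := hγ.isPreconnected_velocity (V := {v | ∃ c : ℝ, 0 < c ∧ v = c • J (ν i)})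
      fun j j' hj hj' => honedir i j j' hj hj'
    convert this using 4
    constructor
    · rintro ⟨c, hc, hv⟩
      exact ⟨_, ⟨c, hc, rfl⟩, hv⟩
    · rintro ⟨_, ⟨c, hc, rfl⟩, hv⟩
      exact ⟨c, hc, hv⟩
  · refine hγ.encard_discontinuities_le.trans ?_
    have := Fintype.card_le_of_injective σ hσ
    rw [Fintype.card_fin, Fintype.card_fin] at this
    exact_mod_cast this
  · intro i
    have hFconv : Convex ℝ (F i) := by
      refine (hfac i).1.convex ?_
      rw [hKeq, Set.ofPred_forall]
      refine convex_iInter fun i => ?_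
      exact convex_halfSpace_le ⟨fun x y => inner_add_left x y _,
        fun c x => real_inner_smul_left x _ c⟩ _
    have hdir : ∀ j : Fin k, ∀ t, t ∈ Set.Icc (τ j.castSucc) (τ j.succ) →
        γ t ∈ intrinsicInterior ℝ (F i) → σ j = i := by
      intro j t ht hint
      -- At a relatively interior point of `F i` the normal cone is the ray of `ν i`, but it also
      -- contains the normal `ν (σ j)` of the current piece. So only the piece with `σ j = i` can
      -- visit that interior.
      obtain ⟨c, hc, he⟩ := (hF.normal i).eq_smul_of_mem_normalCone h0 (hfac i) hint
        (hcone j t ht 1 zero_le_one)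
      refine hνinj 1 c one_pos (lt_of_le_of_ne hc fun h => ?_) _ _ he
      rw [← h, zero_smul, one_smul] at he
      exact hνne _ he
    exact hγ.isPreconnected_mem_convex hFconv.intrinsicInterior_of_real
      fun j j' t t' ht ht' hC hC' => hσ ((hdir j t ht hC).trans (hdir j' t' ht' hC').symm)
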